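/- **Bounded-space bin packing.** Fix a positive integer $M$. A finite sequence of items $a_1,\dots,a_n\in[0,1]$ is to be packed, in this order, into bins of size $1$, the allowed operations being: open a new bin, close an open bin, put the current item into some open bin; at no time may more than $M$ bins be open. Let $\mathrm{opt}_{\rm BP}$ be the minimum number of unit bins into which the items fit in the offline setting. Let $\beta_M,\gamma_M$ be real numbers such that every finite sequence of items in $[0,1]$ has such a bounded-space packing that opens at most $\beta_M\cdot\mathrm{opt}_{\rm BP}+\gamma_M$ bins. **Tree DVRP.** Let $T=(V,E)$ be a finite tree with non-negative integer edge weights, rooted at the depot $r$, in which every non-leaf vertex has exactly two children; let the set $U$ of terminals be the set of leaves, and let $D$ be a positive integer. A feasible solution is a finite set of closed walks (tours) at $r$, each of length at most $D$, such that every terminal is visited by at least one tour. Assume that a feasible solution exists, and let $\mathrm{opt}$ be the minimum number of tours in a feasible solution. **Algorithm.** Let $\varepsilon>0$ with $\varepsilon^2\le 1/20$ and put $\Gamma=1/\varepsilon^2$. For a connected vertex set $c$ with top vertex $r_c$, let $n_c$ be the minimum number of closed walks at $r_c$ inside $c$, each of length at most $D-2\,\mathrm{dist}(r,r_c)$, that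 visit all terminals in $c$, if this minimum is at most $\Gamma$; otherwise $n_c=+\infty$, and $c$ is called unsolvable. Let $T(v)$ be the subtree rooted at $v$, and for a descendant $e$ of $v$ let $T(v)\setminus T(e)$ be $T(v)$ with all proper descendants of $e$ removed ($e$ itself is kept). The tree is decomposed into components as follows. 1. The leaf components are the $T(v)$ for the least deep vertices $v$ (those without a proper ancestor having the same property) such that $T(v)$ is solvable and, unless $v=r$, $n_{T(v)}\ge\Gamma/2$. Let $T'$ be the subtree spanning $r$ and the roots of the leaf components. 2. For every vertex $b\ne r$ of $T'$ that is the root of a leaf component or has two children in $T'$, let $P$ be the path from $a$ to $b$, where $a$ is the highest ancestor of $b$ such that no vertex of the path other than $b$ has two children in $T'$. Start with $e=b$. While $T(a)\setminus T(e)$ is unsolvable, let $v$ be the least deep vertex of $P$ that is an ancestor of $e$ and for which $T(v)\setminus T(e)$ is solvable, make $T(v)\setminus T(e)$ a component with root $v$, and replace $e$ by $v$. After the loop, the last component of the path is $T(a)\setminus T(e)$ if $a=r$, and otherwise $T(a)\setminus T(e)$ together with the edge from the parent of $a$ to $a$, with that parent as root. The algorithm outputs $\sum_c n_c$, the sum being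 over all components $c$. **Theorem.** Under these assumptions the output of the algorithm is a finite number $N$, there is a feasible solution with at most $N$ tours, and $$N\le(\beta_M+30\varepsilon^2M)\cdot\mathrm{opt}+\gamma_M .$$ -/

import Mathlib

/-! ## Bounded-space online bin packing -/

/-- State of a packing process: bins are numbered `0, 1, 2, …` in the order in which they are opened;
`opened` is the number of bins opened so far, `active` is the set of bins that are open now, and
`load b` is the total size of the items in bin `b`. -/
structure BinState where
  opened : ℕ
  active : Finset ℕ
  load : ℕ → ℝ

/-- `BinRun M items s`: starting without bins, the items of the list, taken in order, can all be
packed by a sequence of the operations "open a new bin", "close an open bin", "put the current item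
into some open bin", with unit bins and never more than `M` bins open, ending in the state `s`. -/
inductive BinRun (M : ℕ) : List ℝ → BinState → Prop
  | start : BinRun M [] ⟨0, ∅, fun _ => 0⟩
  | openBin {items : List ℝ} {s : BinState} (h : BinRun M items s) (hM : s.active.card < M) :
      BinRun M items ⟨s.opened + 1, insert s.opened s.active, s.load⟩
  | closeBin {items : List ℝ} {s : BinState} (h : BinRun M items s) (b : ℕ) (hb : b ∈ s.active) :
      BinRun M items ⟨s.opened, s.active.erase b, s.load⟩
  | assign {items : List ℝ} {s : BinState} (h : BinRun M items s) (a : ℝ) (b : ℕ)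
      (hb : b ∈ s.active) (hfit : s.load b + a ≤ 1) :
      BinRun M (items ++ [a])
        ⟨s.opened, s.active, Function.update s.load b (s.load b + a)⟩

/-- Offline optimum of bin packing: the least number of unit bins into which the items fit. -/
noncomputable def optBinPacking (items : List ℝ) : ℕ :=
  sInf {k : ℕ | ∃ f : Fin items.length → Fin k,
    ∀ b : Fin k, (∑ i ∈ Finset.univ.filter (fun i => f i = b), items.get i) ≤ 1}

/-! ## The distance-constrained vehicle routing problem on trees -/

/-- An instance: a rooted tree with non-negative integer edge weights whose root is the depot, a set
of terminals, and a positive integer distance constraint. -/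
structure TreeDVRP (V : Type*) where
  graph : SimpleGraph V
  isTree : graph.IsTree
  root : V
  weight : Sym2 V → ℕ
  terminals : Set V
  limit : ℕ
  limit_pos : 0 < limit

namespace TreeDVRP

variable {V : Type*} (I : TreeDVRP V)

/-- Length of a walk: sum of the weights of its edges, with multiplicity. -/
def walkLength {u v : V} (t : I.graph.Walk u v) : ℕ := (t.edges.map I.weight).sum

/-- Weighted distance in the tree. -/
noncomputable def dist (u v : V) : ℕ := sInf {l : ℕ | ∃ p : I.graph.Walk u v, I.walkLength p = l}

/-- `v` is an ancestor of `u` (possibly `u` itself). -/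
def IsAncestor (v u : V) : Prop := ∀ p : I.graph.Walk I.root u, v ∈ p.support

/-- `u` is a child of `v`. -/
def IsChild (v u : V) : Prop := I.graph.Adj v u ∧ I.IsAncestor v u

/-- The vertices of the subtree `T(v)` rooted at `v`. -/
def subtree (v : V) : Set V := {u | I.IsAncestor v u}

/-- The standing normalization: every vertex has no child or exactly two children, and the terminals
are exactly the leaves. -/
def IsNormalized : Prop :=
  (∀ v, {u | I.IsChild v u} = ∅ ∨ {u | I.IsChild v u}.ncard = 2) ∧
    I.terminals = {v | ∀ u, ¬ I.IsChild v u}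

/-- `S` is a feasible solution of the subproblem on the vertex set `c` with depot `ρ` and distance
constraint `d`: all tours in `S` are closed walks at `ρ` inside `c` of length at most `d`, and every
terminal in `c` is visited. -/
def IsFeasible (ρ : V) (c : Set V) (d : ℤ) (S : Finset (I.graph.Walk ρ ρ)) : Prop :=
  (∀ t ∈ S, (∀ x ∈ t.support, x ∈ c) ∧ (I.walkLength t : ℤ) ≤ d) ∧
    ∀ u ∈ I.terminals, u ∈ c → ∃ t ∈ S, u ∈ t.support

/-- Optimum of the whole instance (meaningful for instances that have a feasible solution). -/
noncomputable def opt : ℕ :=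
  sInf {k : ℕ | ∃ S, I.IsFeasible I.root Set.univ I.limit S ∧ S.card = k}

/-! ## The approximation algorithm -/

/-- A component: its root vertex and its vertex set (its edges are the tree edges inside that
set). -/
abbrev Component (V : Type*) := V × Set V

/-- Result of `Solve` with bound `Γ` on a component `c` whose distance constraint is `D` minus twice
the distance from the depot to the root of `c`: the least size of a feasible set of at most `Γ`
tours, and `⊤` if there is none. -/
noncomputable def solve (Γ : ℝ) (c : Component V) : ℕ∞ :=
  sInf {n : ℕ∞ | ∃ S : Finset (I.graph.Walk c.1 c.1),
    I.IsFeasible c.1 c.2 ((I.limit : ℤ) - 2 * (I.dist I.root c.1 : ℤ)) S ∧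
      (S.card : ℝ) ≤ Γ ∧ n = (S.card : ℕ∞)}

/-- At most `Γ` tours suffice for the component `c`. -/
def Solvable (Γ : ℝ) (c : Component V) : Prop := I.solve Γ c ≠ ⊤

/-- `T(v)`, as a component with root `v`. -/
def below (v : V) : Component V := (v, I.subtree v)

/-- `T(v) \ T(e)`, as a component with root `v` and exit vertex `e` (the exit vertex belongs to the
component). -/
def between (v e : V) : Component V := (v, (I.subtree v \ I.subtree e) ∪ {e})

/-- `T(v)` may become a leaf component: it can be solved with at most `Γ` tours, and it needs at
least `Γ / 2` tours unless it is the whole tree. -/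
def IsLeafCandidate (Γ : ℝ) (v : V) : Prop :=
  I.Solvable Γ (I.below v) ∧
    (v = I.root ∨ ∀ n : ℕ, I.solve Γ (I.below v) = (n : ℕ∞) → Γ / 2 ≤ (n : ℝ))

/-- The roots of the leaf components: least deep candidates. -/
def IsLeafRoot (Γ : ℝ) (v : V) : Prop :=
  I.IsLeafCandidate Γ v ∧ ∀ u, I.IsAncestor u v → u ≠ v → ¬ I.IsLeafCandidate Γ u

/-- The subtree `T'` spanning the depot and the roots of the leaf components. -/
def backbone (Γ : ℝ) : Set V :=
  {x | x = I.root ∨ ∃ v, I.IsLeafRoot Γ v ∧ I.IsAncestor x v}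

/-- Vertices with two children in `T'`. -/
def IsBranching (Γ : ℝ) (x : V) : Prop :=
  {y | I.IsChild x y ∧ y ∈ I.backbone Γ}.ncard = 2

/-- Lower ends of the maximal downward paths in `T'` whose inner vertices have only one child in
`T'`. -/
def IsPathBottom (Γ : ℝ) (b : V) : Prop :=
  b ≠ I.root ∧ (I.IsLeafRoot Γ b ∨ I.IsBranching Γ b)

/-- The vertices of the path with lower end `b`, without its upper end if that is a branching
vertex. (If the upper end is the depot and the depot is not branching, it is included.) -/
def pathTo (Γ : ℝ) (b : V) : Set V :=
  {x | I.IsAncestor x b ∧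
    ∀ y, I.IsAncestor x y → I.IsAncestor y b → y ≠ b → ¬ I.IsBranching Γ y}

/-- `a` is the least deep vertex of `pathTo Γ b`. -/
def IsPathTop (Γ : ℝ) (b a : V) : Prop :=
  a ∈ I.pathTo Γ b ∧ ∀ x ∈ I.pathTo Γ b, I.IsAncestor a x

/-- `v` is the least deep vertex of the path with lower end `b`, above `e`, such that
`T(v) \ T(e)` can be solved with at most `Γ` tours. -/
def IsCut (Γ : ℝ) (b e v : V) : Prop :=
  v ∈ I.pathTo Γ b ∧ I.IsAncestor v e ∧ I.Solvable Γ (I.between v e) ∧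
    ∀ u ∈ I.pathTo Γ b, I.IsAncestor u v → u ≠ v → ¬ I.Solvable Γ (I.between u e)

/-- The values taken by the lower end `e` of the unprocessed part of the path with lower end `b` and
top `a`: initially `e = b`; as long as `T(a) \ T(e)` cannot be solved with at most `Γ` tours,
`T(v) \ T(e)` is cut off, with `v` as in `IsCut`, and `e` becomes `v`. -/
inductive LoopValue (Γ : ℝ) (b a : V) : V → Prop
  | init : LoopValue Γ b a b
  | step {e v : V} (h : LoopValue Γ b a e) (hloop : ¬ I.Solvable Γ (I.between a e))
      (hcut : I.IsCut Γ b e v) : LoopValue Γ b a v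

/-- The components produced by the decomposition algorithm: leaf components, components cut off in
the loop along each path, and one last component at the upper end of each path. -/
inductive IsComponent (Γ : ℝ) : Component V → Prop
  | leaf {v : V} (h : I.IsLeafRoot Γ v) : IsComponent Γ (I.below v)
  | cut {b a e v : V} (hb : I.IsPathBottom Γ b) (ha : I.IsPathTop Γ b a)
      (h : I.LoopValue Γ b a e) (hloop : ¬ I.Solvable Γ (I.between a e))
      (hcut : I.IsCut Γ b e v) : IsComponent Γ (I.between v e)
  | lastDepot {b e : V} (hb : I.IsPathBottom Γ b) (ha : I.IsPathTop Γ b I.root)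
      (h : I.LoopValue Γ b I.root e) (hloop : I.Solvable Γ (I.between I.root e)) :
      IsComponent Γ (I.between I.root e)
  | last {b a e p : V} (hb : I.IsPathBottom Γ b) (ha : I.IsPathTop Γ b a)
      (h : I.LoopValue Γ b a e) (hloop : I.Solvable Γ (I.between a e)) (hp : I.IsChild p a) :
      IsComponent Γ (p, insert p (I.between a e).2)

/-- The set of all components. -/
noncomputable def components [Finite V] (Γ : ℝ) : Finset (Component V) :=
  (Set.toFinite {c : Component V | I.IsComponent Γ c}).toFinset

/-- Output of the algorithm: the sum over all components of the minimum number of tours. -/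
noncomputable def algorithmOutput [Finite V] (Γ : ℝ) : ℕ∞ :=
  ∑ c ∈ I.components Γ, I.solve Γ c

end TreeDVRP

/-! Identify every edge with its lower end, so that lengths become sums of `parentWeight`. The
vertices visited by a tour form an ancestor-closed set A, and the tour traverses each edge above a
vertex of A at least twice, so 2 w(A) ≤ D (`two_mul_sum_le_walkLength`). Conversely, a subtree is
toured by traversing each edge exactly twice (`exists_tour`).

Cut an optimal solution along the components. A component c has a root and at most one exit vertex
e, below which the tree continues. For a tour with vertex set A let the pivot q be e if A contains
e, and the root of c otherwise. The detour of A in c consists of the edges of A in c that are not on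
the way from the depot to q, and its size is 2 w(detour) / (D − 2 dist(r, q)). Two facts make this
the right notion. Detours in c with the same pivot and total size at most 1 merge into one tour for
c, because the way to q is paid for only once (`exists_combined_tour`). The sizes of the detours of
one tour in all components add up to at most 1 (`sum_detourSize_le_one`): the detours are disjoint
from each other and from the way to the reached pivot farthest from the depot, whose denominator is
the smallest. Hence all detours together are items that fit offline into opt unit bins, one for each
tour.

To serve the components, the detours must be packed separately for each component and each pivot.
Present them group by group to the bounded-space packing. At a group boundary at most M bins are
open, so splitting the bins there costs at most M extra bins per group (`BinRun.groups`). With two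
groups per component this gives N ≤ β opt + γ + 2M·#components (`IsDecomposition.exists_card_le`).

It remains to show that #components ≤ 15 opt / Γ. Leaf components and components cut off in the loop
need at least Γ/2 tours. Every other component is the last one of a path of T', and there are at
most twice as many paths as leaf components, so at least a third of the components are expensive
(`card_components_le`). Greedy packing serves c with at most 2σ + 2 tours, where σ is the total size
of the detours in c (`exists_share`). An expensive component therefore has σ ≥ Γ/4 − 1 ≥ Γ/5, while
the σ sum to at most opt.

If the whole tree is solvable there is one component and N ≤ opt. Then sequences of unit items show
that opt ≤ β opt + γ. -/

namespace TreeDVRP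

variable {V : Type*} (I : TreeDVRP V)

/-! ### Paths, parents, ancestors -/

/-- The path from the depot. -/
noncomputable def path (u : V) : I.graph.Walk I.root u :=
  (I.isTree.existsUnique_path I.root u).choose

theorem path_isPath (u : V) : (I.path u).IsPath :=
  (I.isTree.existsUnique_path I.root u).choose_spec.1

theorem eq_path {u : V} {p : I.graph.Walk I.root u} (hp : p.IsPath) : p = I.path u :=
  (I.isTree.existsUnique_path I.root u).unique hp (I.path_isPath u)

theorem edges_path_sublist {u : V} (p : I.graph.Walk I.root u) :
    (I.path u).edges.Sublist p.edges := by
  classical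
  rw [← I.eq_path p.bypass_isPath]
  exact p.edges_bypass_sublist_edges

theorem support_path_subset {u : V} (p : I.graph.Walk I.root u) :
    (I.path u).support ⊆ p.support := by
  classical
  rw [← I.eq_path p.bypass_isPath]
  exact p.support_bypass_subset_support

theorem isAncestor_iff_mem_path {v u : V} : I.IsAncestor v u ↔ v ∈ (I.path u).support :=
  ⟨fun h => h _, fun h p => I.support_path_subset p h⟩

theorem isAncestor_refl (u : V) : I.IsAncestor u u := fun p => p.end_mem_support

theorem root_isAncestor (u : V) : I.IsAncestor I.root u := fun p => p.start_mem_support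

variable {I} in
theorem IsAncestor.mem_support {v u ρ : V} {p : I.graph.Walk I.root ρ} (h : I.IsAncestor v u)
    (hu : u ∈ p.support) : v ∈ p.support := by
  classical
  exact p.support_takeUntil_subset_support hu (h (p.takeUntil u hu))

variable {I} in
theorem IsAncestor.trans {v w u : V} (h : I.IsAncestor v w) (h' : I.IsAncestor w u) :
    I.IsAncestor v u := fun p => h.mem_support (h' p)

/-- The parent of a vertex; the depot is its own parent. -/
noncomputable def parent (u : V) : V := (I.path u).penultimate

/-- The weight of the edge to the parent. -/
noncomputable def parentWeight (u : V) : ℕ :=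
  open Classical in if u = I.root then 0 else I.weight s(I.parent u, u)

/-- The number of edges between the depot and a vertex. -/
noncomputable def depth (u : V) : ℕ := (I.path u).length

theorem path_root : I.path I.root = SimpleGraph.Walk.nil :=
  (I.eq_path SimpleGraph.Walk.IsPath.nil).symm

@[simp] theorem parentWeight_root : I.parentWeight I.root = 0 := by simp [parentWeight]

theorem not_nil_path {u : V} (hu : u ≠ I.root) : ¬ (I.path u).Nil :=
  SimpleGraph.Walk.not_nil_of_ne hu.symm

theorem adj_parent {u : V} (hu : u ≠ I.root) : I.graph.Adj (I.parent u) u :=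
  SimpleGraph.Walk.adj_penultimate (I.not_nil_path hu)

theorem path_eq_concat {u : V} (hu : u ≠ I.root) :
    I.path u = (I.path (I.parent u)).concat (I.adj_parent hu) := by
  have h := SimpleGraph.Walk.adj_penultimate (I.not_nil_path hu)
  have hp : (I.path u).dropLast = I.path (I.path u).penultimate :=
    I.eq_path (I.path_isPath u).dropLast
  have key : I.path u = (I.path (I.path u).penultimate).concat h := by
    rw [← hp, SimpleGraph.Walk.concat_dropLast]
  exact key

theorem depth_eq {u : V} (hu : u ≠ I.root) : I.depth u = I.depth (I.parent u) + 1 := by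
  rw [depth, I.path_eq_concat hu, SimpleGraph.Walk.length_concat, depth]

theorem parentWeight_eq {u : V} (hu : u ≠ I.root) :
    I.parentWeight u = I.weight s(I.parent u, u) := by simp [parentWeight, hu]

theorem isAncestor_iff {v u : V} (hu : u ≠ I.root) :
    I.IsAncestor v u ↔ v = u ∨ I.IsAncestor v (I.parent u) := by
  rw [isAncestor_iff_mem_path, isAncestor_iff_mem_path, I.path_eq_concat hu,
    SimpleGraph.Walk.support_concat]
  simp [or_comm]

theorem isAncestor_root_iff {v : V} : I.IsAncestor v I.root ↔ v = I.root := by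
  rw [isAncestor_iff_mem_path, path_root]; simp

theorem parent_isAncestor {u : V} (hu : u ≠ I.root) : I.IsAncestor (I.parent u) u :=
  (I.isAncestor_iff hu).2 (Or.inr (I.isAncestor_refl _))

/-- Induction from the depot towards the leaves. -/
theorem parent_induction {P : V → Prop} (h0 : P I.root)
    (h1 : ∀ u, u ≠ I.root → P (I.parent u) → P u) (u : V) : P u := by
  induction h : I.depth u generalizing u with
  | zero =>
    by_cases hu : u = I.root
    · exact hu ▸ h0
    · rw [I.depth_eq hu] at h; omega
  | succ n ih =>
    by_cases hu : u = I.root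
    · exact hu ▸ h0
    · rw [I.depth_eq hu] at h
      exact h1 u hu (ih _ (by omega))

variable {I} in
theorem IsAncestor.depth_le_and {v u : V} (h : I.IsAncestor v u) :
    v = u ∨ I.depth v < I.depth u := by
  induction u using I.parent_induction with
  | h0 => exact Or.inl (I.isAncestor_root_iff.1 h)
  | h1 u hu ih =>
    rw [I.isAncestor_iff hu] at h
    rcases h with h | h
    · exact Or.inl h
    · right
      rw [I.depth_eq hu]
      rcases ih h with h | h
      · rw [h]; omega
      · omega

variable {I} in
theorem IsAncestor.depth_le {v u : V} (h : I.IsAncestor v u) : I.depth v ≤ I.depth u := by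
  rcases h.depth_le_and with h | h
  · rw [h]
  · exact h.le

variable {I} in
theorem IsAncestor.depth_lt {v u : V} (h : I.IsAncestor v u) (hne : v ≠ u) :
    I.depth v < I.depth u := h.depth_le_and.resolve_left hne

variable {I} in
theorem IsAncestor.antisymm {v u : V} (h : I.IsAncestor v u) (h' : I.IsAncestor u v) : v = u := by
  rcases h.depth_le_and with h1 | h1
  · exact h1
  · exact absurd h'.depth_le (by omega)

variable {I} in
theorem IsAncestor.total {v w u : V} (h : I.IsAncestor v u) (h' : I.IsAncestor w u) :
    I.IsAncestor v w ∨ I.IsAncestor w v := by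
  induction u using I.parent_induction with
  | h0 => left; rw [I.isAncestor_root_iff.1 h]; exact I.root_isAncestor _
  | h1 u hu ih =>
    rcases (I.isAncestor_iff hu).1 h with rfl | h1
    · exact Or.inr h'
    · rcases (I.isAncestor_iff hu).1 h' with rfl | h2
      · exact Or.inl h
      · exact ih h1 h2

theorem isChild_iff {p u : V} : I.IsChild p u ↔ u ≠ I.root ∧ p = I.parent u := by
  constructor
  · rintro ⟨hadj, hanc⟩
    have hu : u ≠ I.root := by
      rintro rfl
      exact hadj.ne (I.isAncestor_root_iff.1 hanc)
    refine ⟨hu, ?_⟩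
    have hnot : ¬ u ∈ (I.path p).support := fun h =>
      hadj.ne (hanc.antisymm (I.isAncestor_iff_mem_path.2 h))
    have hpath : ((I.path p).concat hadj).IsPath :=
      (SimpleGraph.Walk.concat_isPath_iff hadj).2 ⟨I.path_isPath p, hnot⟩
    rw [parent, ← I.eq_path hpath]
    simp
  · rintro ⟨hu, rfl⟩
    exact ⟨I.adj_parent hu, I.parent_isAncestor hu⟩

variable {I} in
theorem IsChild.isAncestor {p u : V} (h : I.IsChild p u) : I.IsAncestor p u := h.2

variable {I} in
theorem IsChild.ne {p u : V} (h : I.IsChild p u) : p ≠ u := h.1.ne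

variable {I} in
theorem IsChild.ne_root {p u : V} (h : I.IsChild p u) : u ≠ I.root := (I.isChild_iff.1 h).1

variable {I} in
theorem IsChild.depth_eq {p u : V} (h : I.IsChild p u) : I.depth u = I.depth p + 1 := by
  obtain ⟨hu, rfl⟩ := I.isChild_iff.1 h
  exact I.depth_eq hu

variable {I} in
theorem IsChild.unique {p q u : V} (h : I.IsChild p u) (h' : I.IsChild q u) : p = q := by
  rw [(I.isChild_iff.1 h).2, (I.isChild_iff.1 h').2]

theorem isChild_parent {u : V} (hu : u ≠ I.root) : I.IsChild (I.parent u) u :=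
  I.isChild_iff.2 ⟨hu, rfl⟩

variable {I} in
theorem IsChild.isAncestor_of_ne {p u v : V} (h : I.IsChild p u) (hv : I.IsAncestor v u)
    (hne : v ≠ u) : I.IsAncestor v p := by
  obtain ⟨hu, rfl⟩ := I.isChild_iff.1 h
  exact ((I.isAncestor_iff hu).1 hv).resolve_left hne

variable {I} in
/-- The child of an ancestor in the direction of a proper descendant. -/
theorem IsAncestor.exists_child {v u : V} (h : I.IsAncestor v u) (hne : v ≠ u) :
    ∃ w, I.IsChild v w ∧ I.IsAncestor w u := by
  induction u using I.parent_induction with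
  | h0 => exact absurd (I.isAncestor_root_iff.1 h) hne
  | h1 u hu ih =>
    have h1 := ((I.isAncestor_iff hu).1 h).resolve_left hne
    by_cases hv : v = I.parent u
    · exact ⟨u, hv ▸ I.isChild_parent hu, I.isAncestor_refl u⟩
    · obtain ⟨w, hw, hw'⟩ := ih h1 hv
      exact ⟨w, hw, hw'.trans (I.parent_isAncestor hu)⟩

variable {I} in
theorem IsChild.not_isAncestor {p u : V} (h : I.IsChild p u) : ¬ I.IsAncestor u p :=
  fun h' => h.ne (h.isAncestor.antisymm h')

/-- Distinct siblings have no common descendant. -/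
theorem child_unique {p u u' x : V} (h : I.IsChild p u) (h' : I.IsChild p u')
    (hx : I.IsAncestor u x) (hx' : I.IsAncestor u' x) : u = u' := by
  by_contra hne
  rcases hx.total hx' with h1 | h1
  · exact h.not_isAncestor (h'.isAncestor_of_ne h1 hne)
  · exact h'.not_isAncestor (h.isAncestor_of_ne h1 (Ne.symm hne))

/-- Two incomparable vertices are separated at some vertex. -/
theorem exists_branch {z b b' : V} (hb : I.IsAncestor z b) (hb' : I.IsAncestor z b')
    (h : ¬ I.IsAncestor b b') (h' : ¬ I.IsAncestor b' b) :
    ∃ y u u', I.IsAncestor z y ∧ I.IsChild y u ∧ I.IsChild y u' ∧ u ≠ u' ∧ I.IsAncestor u b ∧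
      I.IsAncestor u' b' := by
  induction n : I.depth b - I.depth z generalizing z with
  | zero =>
    have := hb.depth_le_and
    rcases this with rfl | h1
    · exact absurd hb' h
    · omega
  | succ n ih =>
    have hzb : z ≠ b := by rintro rfl; exact h hb'
    have hzb' : z ≠ b' := by rintro rfl; exact h' hb
    obtain ⟨u, hu, hub⟩ := hb.exists_child hzb
    obtain ⟨u', hu', hub'⟩ := hb'.exists_child hzb'
    by_cases he : u = u'
    · subst he
      obtain ⟨y, v, v', hy, hv⟩ := ih hub hub' (by have := hu.depth_eq; omega)
      exact ⟨y, v, v', hu.isAncestor.trans hy, hv⟩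
    · exact ⟨z, u, u', I.isAncestor_refl z, hu, hu', he, hub, hub'⟩

/-- A vertex of least depth among those with a given property. -/
theorem exists_minimal_depth {P : V → Prop} (h : ∃ v, P v) :
    ∃ v, P v ∧ ∀ w, P w → I.depth v ≤ I.depth w := by
  obtain ⟨v, hv, hmin⟩ := (measure I.depth).wf.has_min {v | P v} h
  exact ⟨v, hv, fun w hw => not_lt.1 (hmin w hw)⟩

/-- Induction from the leaves towards the depot. -/
theorem descendant_induction [Finite V] {P : V → Prop}
    (h : ∀ u, (∀ v, I.IsChild u v → P v) → P u) (u : V) : P u := by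
  obtain ⟨N, hN⟩ := (Set.finite_range I.depth).bddAbove
  induction n : N - I.depth u generalizing u with
  | zero =>
    refine h u fun v hv => ?_
    have h1 : I.depth v ≤ N := hN ⟨v, rfl⟩
    have := hv.depth_eq
    omega
  | succ n ih =>
    exact h u fun v hv => ih v (by have := hv.depth_eq; omega)

/-! ### Distances and lengths of walks -/

@[simp] theorem walkLength_nil {u : V} :
    I.walkLength (SimpleGraph.Walk.nil : I.graph.Walk u u) = 0 := rfl

@[simp] theorem walkLength_append {u v w : V} (p : I.graph.Walk u v) (q : I.graph.Walk v w) :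
    I.walkLength (p.append q) = I.walkLength p + I.walkLength q := by
  simp [walkLength, SimpleGraph.Walk.edges_append]

@[simp] theorem walkLength_cons {u v w : V} (h : I.graph.Adj u v) (q : I.graph.Walk v w) :
    I.walkLength (.cons h q) = I.weight s(u, v) + I.walkLength q := by
  simp [walkLength]

@[simp] theorem walkLength_concat {u v w : V} (q : I.graph.Walk u v) (h : I.graph.Adj v w) :
    I.walkLength (q.concat h) = I.walkLength q + I.weight s(v, w) := by
  simp [walkLength, SimpleGraph.Walk.edges_concat]

@[simp] theorem walkLength_reverse {u v : V} (q : I.graph.Walk u v) :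
    I.walkLength q.reverse = I.walkLength q := by
  simp [walkLength, SimpleGraph.Walk.edges_reverse]

theorem dist_root_eq (u : V) : I.dist I.root u = I.walkLength (I.path u) := by
  refine le_antisymm (Nat.sInf_le ⟨I.path u, rfl⟩) (le_csInf ⟨_, I.path u, rfl⟩ ?_)
  rintro _ ⟨p, rfl⟩
  exact ((I.edges_path_sublist p).map I.weight).sum_le_sum fun _ _ => Nat.zero_le _

@[simp] theorem dist_root_root : I.dist I.root I.root = 0 := by
  rw [dist_root_eq, path_root]; rfl

theorem dist_root_parent {u : V} (hu : u ≠ I.root) :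
    I.dist I.root u = I.dist I.root (I.parent u) + I.parentWeight u := by
  rw [dist_root_eq, dist_root_eq, I.path_eq_concat hu, walkLength_concat, I.parentWeight_eq hu]

variable {I} in
theorem IsChild.dist_root {p u : V} (h : I.IsChild p u) :
    I.dist I.root u = I.dist I.root p + I.weight s(p, u) := by
  obtain ⟨hu, rfl⟩ := I.isChild_iff.1 h
  rw [I.dist_root_parent hu, I.parentWeight_eq hu]

theorem parent_edge_mem {x : V} (hx : x ≠ I.root) (p : I.graph.Walk I.root x) :
    s(I.parent x, x) ∈ p.edges :=
  (I.edges_path_sublist p).subset (SimpleGraph.Walk.mk_penultimate_end_mem_edges (I.not_nil_path hx))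

open Classical in
/-- The distance from the depot is the weight of the edges above the vertex. -/
theorem sum_ancestors [Fintype V] (u : V) :
    ∑ x ∈ Finset.univ.filter (fun x => I.IsAncestor x u), I.parentWeight x = I.dist I.root u := by
  induction u using I.parent_induction with
  | h0 =>
    simp [isAncestor_root_iff]
  | h1 u hu ih =>
    have : Finset.univ.filter (fun x => I.IsAncestor x u) =
        insert u (Finset.univ.filter (fun x => I.IsAncestor x (I.parent u))) := by
      ext x; simp [I.isAncestor_iff hu]
    rw [this, Finset.sum_insert, ih, I.dist_root_parent hu, add_comm]
    simpa using (I.isChild_parent hu).not_isAncestor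

open Classical in
/-- A tour traverses each edge of the subtree it spans at least twice. -/
theorem two_mul_sum_le_walkLength (t : I.graph.Walk I.root I.root) :
    2 * ∑ x ∈ t.support.toFinset, I.parentWeight x ≤ I.walkLength t := by
  -- Cut the tour at a visit of x: the part before it and the reverse of the part after it are both
  -- walks from the depot to x, and each of them uses the edge above x.
  have hcount : ∀ x ∈ t.support.toFinset.erase I.root, 2 ≤ t.edges.count s(I.parent x, x) := by
    intro x hx
    have hx1 : x ≠ I.root := Finset.ne_of_mem_erase hx
    have hx2 : x ∈ t.support := by simpa using Finset.mem_of_mem_erase hx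
    rw [← t.take_spec hx2, SimpleGraph.Walk.edges_append, List.count_append]
    have h1 := List.count_pos_iff.2 (I.parent_edge_mem hx1 (t.takeUntil x hx2))
    have h2 := List.count_pos_iff.2 (I.parent_edge_mem hx1 (t.dropUntil x hx2).reverse)
    rw [SimpleGraph.Walk.edges_reverse, List.count_reverse] at h2
    omega
  have hinj : Set.InjOn (fun x => s(I.parent x, x)) (t.support.toFinset.erase I.root : Finset V) := by
    intro x hx y hy hxy
    have hx1 : x ≠ I.root := Finset.ne_of_mem_erase hx
    have hy1 : y ≠ I.root := Finset.ne_of_mem_erase hy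
    simp only [Sym2.eq_iff] at hxy
    rcases hxy with h | h
    · exact h.2
    · have h1 := I.depth_eq hx1
      have h2 := I.depth_eq hy1
      rw [h.1] at h1
      rw [← h.2] at h2
      omega
  have hsum : ∑ x ∈ t.support.toFinset, I.parentWeight x =
      ∑ x ∈ t.support.toFinset.erase I.root, I.weight s(I.parent x, x) := by
    rw [← Finset.sum_erase t.support.toFinset (I.parentWeight_root)]
    exact Finset.sum_congr rfl fun x hx => I.parentWeight_eq (Finset.ne_of_mem_erase hx)
  rw [hsum, walkLength, Finset.sum_list_map_count, Finset.mul_sum]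
  calc ∑ x ∈ t.support.toFinset.erase I.root, 2 * I.weight s(I.parent x, x)
      ≤ ∑ x ∈ t.support.toFinset.erase I.root,
          t.edges.count s(I.parent x, x) • I.weight s(I.parent x, x) :=
        Finset.sum_le_sum fun x hx => Nat.mul_le_mul_right _ (hcount x hx)
    _ = ∑ e ∈ (t.support.toFinset.erase I.root).image (fun x => s(I.parent x, x)),
          t.edges.count e • I.weight e := by
        rw [Finset.sum_image hinj]
    _ ≤ _ := by
        refine Finset.sum_le_sum_of_subset fun e he => ?_
        obtain ⟨x, hx, rfl⟩ := Finset.mem_image.1 he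
        exact List.mem_toFinset.2 (List.count_pos_iff.1 (by have := hcount x hx; omega))

open Classical in
/-- A subtree containing `ρ` as its top vertex is spanned by a closed walk at `ρ` that traverses
each of its edges twice. -/
theorem exists_tour (ρ : V) (B : Finset V) (hρ : ρ ∈ B)
    (hB : ∀ x ∈ B, x ≠ ρ → x ≠ I.root ∧ I.parent x ∈ B) :
    ∃ t : I.graph.Walk ρ ρ, (∀ x, x ∈ t.support ↔ x ∈ B) ∧
      I.walkLength t = 2 * ∑ x ∈ B.erase ρ, I.parentWeight x := by
  induction n : B.card generalizing B with
  | zero => simp [Finset.card_eq_zero.1 n] at hρ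
  | succ n ih =>
    by_cases hne : (B.erase ρ).Nonempty
    -- A deepest vertex other than `ρ` is the parent of no vertex of `B` except possibly `ρ`, which
    -- is exempt. So it can be removed, and its edge is put back as an excursion from its parent.
    · obtain ⟨x, hx, hmax⟩ := Finset.exists_max_image _ I.depth hne
      have hxρ := Finset.ne_of_mem_erase hx
      have hxB := Finset.mem_of_mem_erase hx
      obtain ⟨hx0, hpx⟩ := hB x hxB hxρ
      have hchild := I.isChild_parent hx0
      obtain ⟨t, ht, hlen⟩ := ih (B.erase x) (Finset.mem_erase.2 ⟨hxρ.symm, hρ⟩)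
        (by
          intro y hy hyρ
          obtain ⟨hy0, hpy⟩ := hB y (Finset.mem_of_mem_erase hy) hyρ
          refine ⟨hy0, Finset.mem_erase.2 ⟨?_, hpy⟩⟩
          intro h
          have h1 := hmax y (Finset.mem_erase.2 ⟨hyρ, Finset.mem_of_mem_erase hy⟩)
          have h2 := I.depth_eq hy0
          rw [h] at h2
          omega)
        (by rw [Finset.card_erase_of_mem hxB]; omega)
      have hp : I.parent x ∈ t.support := (ht _).2 (Finset.mem_erase.2 ⟨hchild.ne, hpx⟩)
      refine ⟨(t.takeUntil _ hp).append
        (.cons hchild.1 (.cons hchild.1.symm (t.dropUntil _ hp))), ?_, ?_⟩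
      · intro y
        have h1 : y ∈ t.support ↔ y ∈ (t.takeUntil _ hp).support ∨ y ∈ (t.dropUntil _ hp).support := by
          rw [← SimpleGraph.Walk.mem_support_append_iff, t.take_spec hp]
        have h2 := ht y
        rw [h1, Finset.mem_erase] at h2
        have h3 : I.parent x ∈ (t.dropUntil _ hp).support := SimpleGraph.Walk.start_mem_support _
        simp only [SimpleGraph.Walk.mem_support_append_iff, SimpleGraph.Walk.support_cons,
          List.mem_cons]
        by_cases hyx : y = x
        · simp [hyx, hxB]
        · by_cases hyp : y = I.parent x
          · rw [hyp]; simp [hpx]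
          · simp only [hyx, hyp, false_or]
            rw [h2]; simp [hyx]
      · have h1 : I.walkLength t =
            I.walkLength (t.takeUntil _ hp) + I.walkLength (t.dropUntil _ hp) := by
          rw [← walkLength_append, t.take_spec hp]
        have h2 : ∑ y ∈ B.erase ρ, I.parentWeight y =
            I.parentWeight x + ∑ y ∈ (B.erase x).erase ρ, I.parentWeight y := by
          rw [Finset.erase_right_comm, Finset.add_sum_erase _ _ hx]
        rw [walkLength_append, walkLength_cons, walkLength_cons, h2, I.parentWeight_eq hx0,
          Sym2.eq_swap (a := x)]
        omega
    · have hB1 : B = {ρ} := by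
        ext y
        rw [Finset.mem_singleton]
        constructor
        · intro hy
          by_contra h
          exact hne ⟨y, Finset.mem_erase.2 ⟨h, hy⟩⟩
        · rintro rfl; exact hρ
      subst hB1
      exact ⟨.nil, by simp, by simp⟩

end TreeDVRP

/-! ### Bounded-space packings of grouped items -/

namespace BinRun

variable {M : ℕ} {items : List ℝ} {s : BinState}

theorem lt_opened (h : BinRun M items s) : ∀ b ∈ s.active, b < s.opened := by
  induction h with
  | start => simp
  | openBin h hM ih =>
    intro b hb
    rcases Finset.mem_insert.1 hb with rfl | hb
    · exact Nat.lt_succ_self _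
    · exact (ih b hb).trans (Nat.lt_succ_self _)
  | closeBin h b hb ih => exact fun c hc => ih c (Finset.mem_of_mem_erase hc)
  | assign h a b hb hfit ih => exact ih

theorem card_active_le (h : BinRun M items s) : s.active.card ≤ M := by
  induction h with
  | start => simp
  | openBin h hM ih => exact (Finset.card_insert_le _ _).trans hM
  | closeBin h b hb ih => exact (Finset.card_erase_le).trans ih
  | assign h a b hb hfit ih => exact ih

theorem load_le_one (h : BinRun M items s) (b : ℕ) : s.load b ≤ 1 := by
  induction h with
  | start => simp
  | openBin h hM ih => exact ih
  | closeBin h b hb ih => exact ih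
  | assign h a c hc hfit ih =>
    by_cases hbc : b = c
    · subst hbc; simpa using hfit
    · simpa [hbc] using ih

theorem load_nonneg (h : BinRun M items s) (h0 : ∀ a ∈ items, 0 ≤ a) (b : ℕ) : 0 ≤ s.load b := by
  induction h with
  | start => simp
  | openBin h hM ih => exact ih h0
  | closeBin h b hb ih => exact ih h0
  | assign h a c hc hfit ih =>
    have h1 := ih fun x hx => h0 x (List.mem_append_left _ hx)
    have h2 := h0 a (by simp)
    by_cases hbc : b = c
    · subst hbc; simpa using add_nonneg h1 h2
    · simpa [hbc] using h1

end BinRun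

/-- Redirecting a new item to the bin `c`. -/
theorem sum_insert_update {ι : Type*} [DecidableEq ι] {J : Finset ι} {i : ι} (hi : i ∉ J)
    (f : ι → ℕ) (sz : ι → ℝ) (b c : ℕ) :
    ∑ x ∈ (insert i J).filter (fun x => Function.update f i c x = b), sz x =
      (∑ x ∈ J.filter (fun x => f x = b), sz x) + if c = b then sz i else 0 := by
  have h1 : J.filter (fun x => Function.update f i c x = b) = J.filter (fun x => f x = b) :=
    Finset.filter_congr fun x hx => by
      rw [Function.update_of_ne (ne_of_mem_of_not_mem hx hi)]
  rw [Finset.filter_insert, h1]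
  by_cases hcb : c = b
  · rw [if_pos (by simpa using hcb), Finset.sum_insert (by simp [hi]), if_pos hcb, add_comm]
  · rw [if_neg (by simpa using hcb), if_neg hcb, add_zero]

namespace BinRun

variable {M : ℕ} {items : List ℝ} {s : BinState}

/-- The last part of a run: its items go to bins that are active at its start or opened during
it. -/
theorem segment {κ : Type*} [DecidableEq κ] (h : BinRun M items s) (sz : κ → ℝ) (l₁ : List ℝ)
    (l₂ : List κ) (hnd : l₂.Nodup) (he : items = l₁ ++ l₂.map sz) :
    ∃ s₁, BinRun M l₁ s₁ ∧ s₁.opened ≤ s.opened ∧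
      (∀ b ∈ s.active, b ∈ s₁.active ∨ s₁.opened ≤ b) ∧
      ∃ f : κ → ℕ, (∀ x ∈ l₂, f x ∈ s₁.active ∨ (s₁.opened ≤ f x ∧ f x < s.opened)) ∧
        ∀ b, s₁.load b + ∑ x ∈ l₂.toFinset.filter (fun x => f x = b), sz x = s.load b := by
  induction h generalizing l₂ with
  | start =>
    have h1 : l₁ = [] ∧ l₂ = [] := by simpa using he.symm
    obtain ⟨rfl, rfl⟩ := h1
    exact ⟨_, .start, le_rfl, by simp, fun _ => 0, by simp, by simp⟩
  | openBin h hM ih =>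
    obtain ⟨s₁, hs₁, ho, ha, f, hf, hl⟩ := ih l₂ hnd he
    refine ⟨s₁, hs₁, ho.trans (Nat.le_succ _), ?_, f, ?_, hl⟩
    · intro b hb
      rcases Finset.mem_insert.1 hb with rfl | hb
      · exact Or.inr ho
      · exact ha b hb
    · intro x hx
      rcases hf x hx with h1 | h1
      · exact Or.inl h1
      · exact Or.inr ⟨h1.1, h1.2.trans (Nat.lt_succ_self _)⟩
  | closeBin h b hb ih =>
    obtain ⟨s₁, hs₁, ho, ha, f, hf, hl⟩ := ih l₂ hnd he
    exact ⟨s₁, hs₁, ho, fun c hc => ha c (Finset.mem_of_mem_erase hc), f, hf, hl⟩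
  | @assign its s h a c hc hfit ih =>
    rcases List.eq_nil_or_concat l₂ with rfl | ⟨l, i, rfl⟩
    · simp only [List.map_nil, List.append_nil] at he
      subst he
      -- `s₁` is the state right after the last item of `l₁`. Bins opened between that item and the
      -- first item of `l₂` thus count as opened during the last part.
      exact ⟨_, .assign h a c hc hfit, le_rfl, fun b hb => Or.inl hb, fun _ => 0, by simp, by simp⟩
    · rw [List.concat_eq_append] at hnd ⊢
      rw [List.concat_eq_append, List.map_append, ← List.append_assoc, List.map_singleton] at he
      obtain ⟨he1, he2⟩ := List.append_inj' he rfl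
      have he2 : a = sz i := by simpa using he2
      have hnd' := List.nodup_append.1 hnd
      have hil : i ∉ l := fun hi => hnd'.2.2 i hi i (by simp) rfl
      obtain ⟨s₁, hs₁, ho, ha, f, hf, hl⟩ := ih l hnd'.1 he1
      refine ⟨s₁, hs₁, ho, ha, Function.update f i c, ?_, ?_⟩
      · intro x hx
        by_cases hxi : x = i
        · subst hxi
          rw [Function.update_self]
          exact (ha c hc).imp id fun h1 => ⟨h1, h.lt_opened c hc⟩
        · rw [Function.update_of_ne hxi]
          exact hf x (by simpa [hxi] using hx)
      · intro b
        have h1 : (l ++ [i]).toFinset = insert i l.toFinset := by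
          ext x; simp
        rw [h1, sum_insert_update (by simpa using hil), ← add_assoc, hl b]
        by_cases hcb : c = b
        · subst hcb; simp [he2]
        · simp [hcb, Ne.symm hcb]

/-- A run on a sequence of groups of items: in total over the groups, the number of bins used
exceeds the number of opened bins by at most `M` for each group. -/
theorem groups {γ ι : Type*} [DecidableEq γ] [DecidableEq ι] (G : List γ) (hG : G.Nodup)
    (J : γ → Finset ι) (sz : γ → ι → ℝ) (h0 : ∀ g ∈ G, ∀ i ∈ J g, 0 ≤ sz g i)
    (h : BinRun M (G.flatMap fun g => (J g).toList.map (sz g)) s) :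
    ∃ f : γ → ι → ℕ,
      (∀ g ∈ G, ∀ b, ∑ i ∈ (J g).filter (fun i => f g i = b), sz g i ≤ 1) ∧
      (G.map fun g => ((J g).image (f g)).card).sum ≤ s.opened + M * G.length := by
  induction G using List.reverseRecOn generalizing s with
  | nil => exact ⟨fun _ _ => 0, by simp, by simp⟩
  | append_singleton G g ih =>
    have hnd := List.nodup_append.1 hG
    have hgG : g ∉ G := fun hg => hnd.2.2 g hg g (by simp) rfl
    obtain ⟨s₁, hs₁, ho, -, f, hf, hl⟩ := h.segment (sz g)
      (G.flatMap fun g => (J g).toList.map (sz g)) (J g).toList (Finset.nodup_toList _)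
      (by simp)
    obtain ⟨F, hF, hsum⟩ := ih hnd.1 (fun g hg => h0 g (by simp [hg])) hs₁
    refine ⟨Function.update F g f, ?_, ?_⟩
    · intro g' hg' b
      by_cases hgg : g' = g
      · subst hgg
        rw [Function.update_self]
        have h1 := hl b
        rw [Finset.toList_toFinset] at h1
        have h2 := h.load_le_one b
        have h3 := hs₁.load_nonneg (by
          intro a ha
          obtain ⟨k, hk, ha⟩ := List.mem_flatMap.1 ha
          obtain ⟨i, hi, rfl⟩ := List.mem_map.1 ha
          exact h0 k (by simp [hk]) i (by simpa using hi)) b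
        linarith
      · rw [Function.update_of_ne hgg]
        exact hF g' (by simpa [hgg] using hg') b
    · have h1 : (G.map fun k => ((J k).image (Function.update F g f k)).card) =
          G.map fun k => ((J k).image (F k)).card :=
        List.map_congr_left fun k hk => by
          rw [Function.update_of_ne (ne_of_mem_of_not_mem hk hgG)]
      -- Only bins that are active when the group starts can be counted a second time, and there are
      -- at most `M` of them. The newly opened bins telescope over the groups.
      have h2 : ((J g).image f).card ≤ M + (s.opened - s₁.opened) := by
        calc ((J g).image f).card ≤ (s₁.active ∪ Finset.Ico s₁.opened s.opened).card := by
              refine Finset.card_le_card fun b hb => ?_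
              obtain ⟨i, hi, rfl⟩ := Finset.mem_image.1 hb
              simpa using hf i (by simpa using hi)
          _ ≤ _ := (Finset.card_union_le _ _).trans (by
              rw [Nat.card_Ico]; exact Nat.add_le_add_right hs₁.card_active_le _)
      rw [List.map_append, List.sum_append, h1, List.length_append, List.map_singleton,
        List.sum_singleton, Function.update_self, List.length_singleton, Nat.mul_add, Nat.mul_one]
      omega

end BinRun

/-! ### Offline packings, greedy packings and packings by groups -/

/-- An assignment of items to the elements of `T` bounds the offline optimum. -/
theorem optBinPacking_le {κ ι : Type*} [DecidableEq κ] [DecidableEq ι] (L : List κ) (hL : L.Nodup)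
    (sz : κ → ℝ) (T : Finset ι) (h : κ → ι) (hT : ∀ x ∈ L, h x ∈ T)
    (hle : ∀ t ∈ T, ∑ x ∈ L.toFinset.filter (fun x => h x = t), sz x ≤ 1) :
    optBinPacking (L.map sz) ≤ T.card := by
  have hget : ∀ i : Fin (L.map sz).length, L[i.1]'(by simpa using i.2) ∈ L := fun i =>
    List.getElem_mem _
  refine Nat.sInf_le ⟨fun i => T.equivFin ⟨h (L[i.1]'(by simpa using i.2)), hT _ (hget i)⟩, ?_⟩
  intro b
  refine le_of_eq_of_le ?_ (hle _ (T.equivFin.symm b).2)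
  refine Finset.sum_bij (fun i _ => L[i.1]'(by simpa using i.2)) ?_ ?_ ?_ ?_
  · intro i hi
    have hi := (Finset.mem_filter.1 hi).2
    refine Finset.mem_filter.2 ⟨List.mem_toFinset.2 (hget i), ?_⟩
    rw [← hi]; simp
  · intro i _ j _ hij
    exact Fin.ext ((hL.getElem_inj_iff).1 hij)
  · intro x hx
    obtain ⟨hx1, hx2⟩ := Finset.mem_filter.1 hx
    obtain ⟨n, hn, rfl⟩ := List.getElem_of_mem (List.mem_toFinset.1 hx1)
    refine ⟨⟨n, by simpa using hn⟩, ?_, rfl⟩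
    simp only [Finset.mem_filter, Finset.mem_univ, true_and]
    rw [← Equiv.eq_symm_apply]
    exact Subtype.ext hx2
  · intro i _
    simp

/-- Items of size at most `1` fit into fewer than twice their total size plus two unit bins. -/
theorem exists_packing {ι : Type*} [DecidableEq ι] (J : Finset ι) (sz : ι → ℝ)
    (h0 : ∀ i ∈ J, 0 ≤ sz i) (h1 : ∀ i ∈ J, sz i ≤ 1) :
    ∃ f : ι → ℕ, (∀ b, ∑ i ∈ J.filter (fun i => f i = b), sz i ≤ 1) ∧
      ((J.image f).card : ℝ) ≤ 2 * ∑ i ∈ J, sz i + 1 := by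
  -- Greedy invariant: every used bin, with at most one exception `b₀`, is more than half full. So
  -- half the number of used bins other than `b₀` is at most the total size.
  suffices H : ∃ f : ι → ℕ, (∀ b, ∑ i ∈ J.filter (fun i => f i = b), sz i ≤ 1) ∧
      ∃ b₀, ∀ b ∈ J.image f, b ≠ b₀ → 1 / 2 < ∑ i ∈ J.filter (fun i => f i = b), sz i by
    obtain ⟨f, hf, b₀, hb₀⟩ := H
    refine ⟨f, hf, ?_⟩
    have h2 : ∑ i ∈ J, sz i = ∑ b ∈ J.image f, ∑ i ∈ J.filter (fun i => f i = b), sz i :=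
      (Finset.sum_fiberwise_of_maps_to (fun i hi => Finset.mem_image_of_mem f hi) _).symm
    have h3 : ∑ _b ∈ (J.image f).erase b₀, (1 / 2 : ℝ) ≤ ∑ i ∈ J, sz i := by
      rw [h2]
      refine (Finset.sum_le_sum fun b hb => ?_).trans
        (Finset.sum_le_sum_of_subset_of_nonneg (Finset.erase_subset b₀ _) fun b _ _ => ?_)
      · exact (hb₀ b (Finset.mem_of_mem_erase hb) (Finset.ne_of_mem_erase hb)).le
      · exact Finset.sum_nonneg fun i hi => h0 i (Finset.mem_filter.1 hi).1
    rw [Finset.sum_const, nsmul_eq_mul] at h3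
    have h4 : (J.image f).card ≤ ((J.image f).erase b₀).card + 1 := by
      have := Finset.pred_card_le_card_erase (s := J.image f) (a := b₀); omega
    have h5 : ((J.image f).card : ℝ) ≤ ((J.image f).erase b₀).card + 1 := by exact_mod_cast h4
    linarith
  induction J using Finset.induction_on with
  | empty => exact ⟨fun _ => 0, by simp, 0, by simp⟩
  | insert i J hi ih =>
    obtain ⟨f, hf, b₀, hb₀⟩ := ih (fun j hj => h0 j (Finset.mem_insert_of_mem hj))
      (fun j hj => h1 j (Finset.mem_insert_of_mem hj))
    have hi0 := h0 i (Finset.mem_insert_self _ _)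
    have hi1 := h1 i (Finset.mem_insert_self _ _)
    have himg : ∀ c, (insert i J).image (Function.update f i c) = insert c (J.image f) := by
      intro c
      rw [Finset.image_insert, Function.update_self]
      congr 1
      exact Finset.image_congr fun x hx => Function.update_of_ne (ne_of_mem_of_not_mem hx hi) _ _
    obtain ⟨n, hn⟩ := Infinite.exists_notMem_finset (J.image f)
    have hempty : ∑ j ∈ J.filter (fun j => f j = n), sz j = 0 := by
      refine Finset.sum_eq_zero fun j hj => ?_
      obtain ⟨hj1, rfl⟩ := Finset.mem_filter.1 hj
      exact absurd (Finset.mem_image_of_mem f hj1) hn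
    -- An item of size at most 1/2 joins a used bin that is at most half full, if there is one.
    -- Otherwise the item gets the fresh bin `n`.
    by_cases hA : (∃ b ∈ J.image f, ∑ j ∈ J.filter (fun j => f j = b), sz j ≤ 1 / 2) ∧ sz i ≤ 1 / 2
    · obtain ⟨⟨c, hc, hc2⟩, hi2⟩ := hA
      have hcb : c = b₀ := by
        by_contra h
        exact absurd (hb₀ c hc h) (not_lt.2 hc2)
      refine ⟨Function.update f i c, fun b => ?_, c, fun b hb hbc => ?_⟩
      · rw [sum_insert_update hi]
        split_ifs with h
        · rw [← h]; linarith
        · rw [add_zero]; exact hf b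
      · rw [himg] at hb
        rw [sum_insert_update hi, if_neg (Ne.symm hbc), add_zero]
        exact hb₀ b ((Finset.mem_insert.1 hb).resolve_left hbc) (hcb ▸ hbc)
    -- An item larger than 1/2 fills its new bin more than half, so the exception stays `b₀`. If the
    -- item is smaller, all old bins are more than half full and `n` becomes the exception.
    · refine ⟨Function.update f i n, fun b => ?_, if 1 / 2 < sz i then b₀ else n,
        fun b hb hbc => ?_⟩
      · rw [sum_insert_update hi]
        split_ifs with h
        · rw [← h, hempty, zero_add]; exact hi1
        · rw [add_zero]; exact hf b
      · rw [himg] at hb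
        rw [sum_insert_update hi]
        rcases Finset.mem_insert.1 hb with rfl | hb
        · rw [if_pos rfl, hempty, zero_add]
          by_contra h
          rw [if_neg h] at hbc
          exact hbc rfl
        · have hbn : n ≠ b := by rintro rfl; exact hn hb
          rw [if_neg hbn, add_zero]
          by_cases hbig : 1 / 2 < sz i
          · rw [if_pos hbig] at hbc
            exact hb₀ b hb hbc
          · by_contra h
            exact hA ⟨⟨b, hb, not_lt.1 h⟩, not_lt.1 hbig⟩

/-- If every sequence has a bounded-space packing with at most `β * opt + γ` bins, then grouped
items that fit into the bins `T` can be packed group by group with `M` extra bins for each group. -/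
theorem exists_grouped_packing {M : ℕ} {β γ : ℝ} (hβ : 0 ≤ β)
    (hBP : ∀ items : List ℝ, (∀ a ∈ items, a ∈ Set.Icc (0 : ℝ) 1) →
      ∃ s : BinState, BinRun M items s ∧ (s.opened : ℝ) ≤ β * (optBinPacking items : ℝ) + γ)
    {κ ι : Type*} [DecidableEq κ] [DecidableEq ι] (G : Finset κ) (J : κ → Finset ι)
    (sz : κ → ι → ℝ) (T : Finset ι) (h0 : ∀ g ∈ G, ∀ i ∈ J g, 0 ≤ sz g i)
    (hJ : ∀ g ∈ G, J g ⊆ T)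
    (hle : ∀ t ∈ T, ∑ g ∈ G.filter (fun g => t ∈ J g), sz g t ≤ 1) :
    ∃ f : κ → ι → ℕ,
      (∀ g ∈ G, ∀ b, ∑ i ∈ (J g).filter (fun i => f g i = b), sz g i ≤ 1) ∧
      ((∑ g ∈ G, ((J g).image (f g)).card : ℕ) : ℝ) ≤ β * T.card + γ + M * G.card := by
  set L : List (κ × ι) := G.toList.flatMap fun g => (J g).toList.map (Prod.mk g) with hLdef
  have hmap : L.map (fun x => sz x.1 x.2) = G.toList.flatMap fun g => (J g).toList.map (sz g) := by
    rw [hLdef, List.map_flatMap]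
    simp [Function.comp_def]
  have hmem : ∀ x, x ∈ L ↔ x.1 ∈ G ∧ x.2 ∈ J x.1 := by
    rintro ⟨g, i⟩
    simp [hLdef]
  have hL : L.Nodup := by
    refine List.nodup_flatMap.2 ⟨fun g _ => (Finset.nodup_toList _).map fun i j h => ?_, ?_⟩
    · exact (Prod.mk.inj h).2
    · refine (Finset.nodup_toList G).imp fun {g g'} hgg => ?_
      intro x hx hx'
      obtain ⟨i, -, rfl⟩ := List.mem_map.1 hx
      obtain ⟨j, -, hj⟩ := List.mem_map.1 hx'
      exact hgg (Prod.mk.inj hj).1.symm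
  have hfib : ∀ t ∈ T, ∑ x ∈ L.toFinset.filter (fun x => x.2 = t), sz x.1 x.2 =
      ∑ g ∈ G.filter (fun g => t ∈ J g), sz g t := by
    intro t ht
    refine Finset.sum_bij' (fun x _ => x.1) (fun g _ => (g, t)) ?_ ?_ ?_ ?_ ?_
    · intro x hx
      simp only [Finset.mem_filter, List.mem_toFinset, hmem] at hx ⊢
      obtain ⟨h, rfl⟩ := hx
      exact h
    · intro g hg
      simp only [Finset.mem_filter, List.mem_toFinset, hmem] at hg ⊢
      exact ⟨hg, trivial⟩
    · intro x hx
      have := (Finset.mem_filter.1 hx).2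
      subst this; rfl
    · intro g hg; rfl
    · intro x hx
      have := (Finset.mem_filter.1 hx).2
      subst this; rfl
  -- The offline packing ignores the groups: the item `(g, t)` goes to bin `t`.
  have hopt : optBinPacking (L.map fun x => sz x.1 x.2) ≤ T.card :=
    optBinPacking_le L hL _ T Prod.snd (fun x hx => hJ _ ((hmem x).1 hx).1 ((hmem x).1 hx).2)
      fun t ht => (hfib t ht).trans_le (hle t ht)
  obtain ⟨s, hs, hso⟩ := hBP (L.map fun x => sz x.1 x.2) (by
    intro a ha
    obtain ⟨⟨g, i⟩, hx, rfl⟩ := List.mem_map.1 ha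
    obtain ⟨hg, hi⟩ := (hmem _).1 hx
    refine ⟨h0 g hg i hi, le_trans ?_ (hle i (hJ g hg hi))⟩
    exact Finset.single_le_sum (f := fun g => sz g i)
      (fun k hk => h0 k (Finset.mem_filter.1 hk).1 i (Finset.mem_filter.1 hk).2)
      (Finset.mem_filter.2 ⟨hg, hi⟩))
  rw [hmap] at hs
  obtain ⟨f, hf, hsum⟩ := hs.groups G.toList (Finset.nodup_toList G) J sz
    (fun g hg => h0 g (by simpa using hg))
  refine ⟨f, fun g hg => hf g (by simpa using hg), ?_⟩
  rw [Finset.sum_map_toList, Finset.length_toList] at hsum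
  have h1 : ((∑ g ∈ G, ((J g).image (f g)).card : ℕ) : ℝ) ≤ s.opened + M * G.card := by
    exact_mod_cast hsum
  have h2 : β * (optBinPacking (L.map fun x => sz x.1 x.2) : ℝ) ≤ β * T.card :=
    mul_le_mul_of_nonneg_left (by exact_mod_cast hopt) hβ
  linarith

/-! ### Unit items force a lower bound on `β * n + γ` -/

theorem injective_of_sum_le_one {ι κ : Type*} [Fintype ι] [DecidableEq κ] {f : ι → κ}
    (h : ∀ b, ∑ _i ∈ Finset.univ.filter (fun i => f i = b), (1 : ℝ) ≤ 1) : f.Injective := by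
  intro i j hij
  have h1 := h (f i)
  rw [Finset.sum_const, nsmul_eq_mul, mul_one] at h1
  have h2 : (Finset.univ.filter (fun k => f k = f i)).card ≤ 1 := by exact_mod_cast h1
  exact Finset.card_le_one.1 h2 i (by simp) j (by simp [hij])

/-- Unit items need one bin each, offline as well as online. -/
theorem natCast_le_of_boundedSpace {M : ℕ} {β γ : ℝ}
    (hBP : ∀ items : List ℝ, (∀ a ∈ items, a ∈ Set.Icc (0 : ℝ) 1) →
      ∃ s : BinState, BinRun M items s ∧ (s.opened : ℝ) ≤ β * (optBinPacking items : ℝ) + γ)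
    (n : ℕ) : (n : ℝ) ≤ β * n + γ := by
  obtain ⟨s, hs, hso⟩ := hBP ((List.finRange n).map fun _ => (1 : ℝ)) (by
    intro a ha
    obtain ⟨_, _, rfl⟩ := List.mem_map.1 ha
    simp)
  have hopt : optBinPacking ((List.finRange n).map fun _ => (1 : ℝ)) = n := by
    refine le_antisymm ?_ (le_csInf ?_ ?_)
    · refine (optBinPacking_le (List.finRange n) (List.nodup_finRange n) _ Finset.univ id
        (fun _ _ => Finset.mem_univ _) fun t _ => ?_).trans (by simp)
      simp [Finset.filter_eq']
    · refine ⟨_, id, fun b => ?_⟩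
      simp [Finset.filter_eq']
    · rintro k ⟨f, hf⟩
      have := Fintype.card_le_of_injective f (injective_of_sum_le_one fun b => by
        simpa using hf b)
      simpa using this
  rw [hopt] at hso
  obtain ⟨s₁, hs₁, ho, -, f, hf, hl⟩ := hs.segment (fun _ => (1 : ℝ)) [] (List.finRange n)
    (List.nodup_finRange n) (by simp)
  have hinj : f.Injective := injective_of_sum_le_one fun b => by
    have h1 := hl b
    have h2 := hs.load_le_one b
    have h3 := hs₁.load_nonneg (by simp) b
    rw [List.toFinset_finRange] at h1
    linarith
  have hcard : n ≤ s.opened := by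
    have := Finset.card_le_card_of_injOn (s := Finset.univ) (t := Finset.range s.opened) f
      (fun x _ => by
        rcases hf x (by simp) with h | h
        · simpa using (hs₁.lt_opened _ h).trans_le ho
        · simpa using h.2) hinj.injOn
    simpa using this
  have : (n : ℝ) ≤ s.opened := by exact_mod_cast hcard
  linarith

/-- If `β < 1`, then `n * (1 - β) ≤ γ` fails for large `n`. Only `0 ≤ β` is needed later, to
multiply the bound on the offline optimum by `β`. -/
theorem one_le_of_boundedSpace {β γ : ℝ} (h : ∀ n : ℕ, (n : ℝ) ≤ β * n + γ) : 1 ≤ β := by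
  by_contra hβ
  obtain ⟨n, hn⟩ := exists_nat_gt (γ / (1 - β))
  rw [div_lt_iff₀ (by linarith)] at hn
  linarith [h n]

namespace TreeDVRP

variable {V : Type*} (I : TreeDVRP V)

/-! ### Splitting tours among the components -/

/-- Shape of a component `c` with exit vertex `e`, where `e` is the root of `c` if nothing is
attached below `c`. -/
structure IsPiece (c : Component V) (e : V) : Prop where
  root_mem : c.1 ∈ c.2
  exit_mem : e ∈ c.2
  isAncestor : ∀ x ∈ c.2, I.IsAncestor c.1 x
  parent_mem : ∀ x ∈ c.2, x ≠ c.1 → I.parent x ∈ c.2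
  -- A component can be left downwards only through its root or its exit. The guard `e ≠ c.1`
  -- switches the exit off for leaf components.
  mem_of_isAncestor : ∀ x ∈ c.2, x ≠ c.1 → ∀ y, I.IsAncestor x y →
    (e ≠ c.1 → ¬ I.IsAncestor e y) → y ∈ c.2
  eq_exit : e ≠ c.1 → ∀ x ∈ c.2, I.IsAncestor e x → x = e

variable {I} in
theorem IsPiece.ne_root {c : Component V} {e x : V} (h : I.IsPiece c e) (hx : x ∈ c.2)
    (hne : x ≠ c.1) : x ≠ I.root := by
  rintro rfl
  exact hne (I.isAncestor_root_iff.1 (h.isAncestor _ hx)).symm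

open Classical in
/-- The edges that a tour spanning `A` uses in the component `c` off the way to the vertex `q`,
given by their lower ends. -/
noncomputable def detour (c : Component V) (q : V) (A : Finset V) : Finset V :=
  A.filter fun x => x ∈ c.2 ∧ ¬ I.IsAncestor x q

variable {I} in
theorem mem_detour {c : Component V} {q x : V} {A : Finset V} :
    x ∈ I.detour c q A ↔ x ∈ A ∧ x ∈ c.2 ∧ ¬ I.IsAncestor x q := by
  classical
  exact Finset.mem_filter

/-- Total length of the detour, relative to what the distance constraint allows. -/
noncomputable def detourSize (c : Component V) (q : V) (A : Finset V) : ℝ :=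
  2 * ((∑ x ∈ I.detour c q A, I.parentWeight x : ℕ) : ℝ) /
    ((I.limit : ℝ) - 2 * (I.dist I.root q : ℝ))

open Classical in
/-- The exit vertex of a component if the tour reaches it, and otherwise the root. -/
noncomputable def pivot (c : Component V) (e : V) (A : Finset V) : V := if e ∈ A then e else c.1

theorem detourSize_nonneg {c : Component V} {q : V} {A : Finset V}
    (hD : 2 * I.dist I.root q ≤ I.limit) : 0 ≤ I.detourSize c q A := by
  have : (2 : ℝ) * (I.dist I.root q : ℝ) ≤ I.limit := by exact_mod_cast hD
  exact div_nonneg (by positivity) (by linarith)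

open Classical in
theorem sum_ancestors_sdiff [Fintype V] {ρ q : V} (h : I.IsAncestor ρ q) :
    ∑ x ∈ Finset.univ.filter (fun x => I.IsAncestor x q ∧ ¬ I.IsAncestor x ρ), I.parentWeight x +
      I.dist I.root ρ = I.dist I.root q := by
  rw [← I.sum_ancestors ρ, ← I.sum_ancestors q]
  rw [← Finset.sum_sdiff (s₁ := Finset.univ.filter (fun x => I.IsAncestor x ρ))
    (s₂ := Finset.univ.filter (fun x => I.IsAncestor x q))]
  · congr 2
    ext x; simp
  · intro x hx
    simp only [Finset.mem_filter, Finset.mem_univ, true_and] at hx ⊢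
    exact hx.trans h

theorem sum_biUnion_le {ι α : Type*} [DecidableEq α] (J : Finset ι) (B : ι → Finset α)
    (w : α → ℕ) : ∑ x ∈ J.biUnion B, w x ≤ ∑ i ∈ J, ∑ x ∈ B i, w x := by
  classical
  induction J using Finset.induction_on with
  | empty => simp
  | insert i J hi ih =>
    rw [Finset.biUnion_insert, Finset.sum_insert hi]
    have := Finset.sum_union_inter (s₁ := B i) (s₂ := J.biUnion B) (f := w)
    omega

open Classical in
/-- Detours on the way to the same vertex that fit into a unit bin combine into one tour. -/
theorem exists_combined_tour [Fintype V] {ι : Type*} {c : Component V} {e q : V} (hc : I.IsPiece c e)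
    (hq : q ∈ c.2) (K : Finset ι) (A : ι → Finset V)
    (hA : ∀ i ∈ K, ∀ x ∈ A i, ∀ y, I.IsAncestor y x → y ∈ A i)
    (hD : ∀ i ∈ K, 2 * ∑ x ∈ I.detour c q (A i), I.parentWeight x + 2 * I.dist I.root q ≤ I.limit)
    (hDq : 2 * I.dist I.root q ≤ I.limit)
    (hK : ∑ i ∈ K, I.detourSize c q (A i) ≤ 1) :
    ∃ t : I.graph.Walk c.1 c.1, (∀ x ∈ t.support, x ∈ c.2) ∧
      (I.walkLength t : ℤ) ≤ (I.limit : ℤ) - 2 * (I.dist I.root c.1 : ℤ) ∧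
      ∀ i ∈ K, ∀ x ∈ A i, x ∈ c.2 → x ∈ t.support := by
  -- The merged tour spans the way from the root of `c` to `q`, which is paid for once, and all the
  -- detours.
  set B : Finset V := Finset.univ.filter fun x =>
    x ∈ c.2 ∧ (I.IsAncestor x q ∨ ∃ i ∈ K, x ∈ A i) with hBdef
  have hρq := hc.isAncestor q hq
  obtain ⟨t, ht, hlen⟩ := I.exists_tour c.1 B (by simp [hBdef, hc.root_mem, hρq]) (by
    intro x hx hxρ
    simp only [hBdef, Finset.mem_filter, Finset.mem_univ, true_and] at hx ⊢
    have hx0 := hc.ne_root hx.1 hxρ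
    refine ⟨hx0, hc.parent_mem x hx.1 hxρ, ?_⟩
    rcases hx.2 with h | ⟨i, hi, h⟩
    · exact Or.inl ((I.parent_isAncestor hx0).trans h)
    · exact Or.inr ⟨i, hi, hA i hi x h _ (I.parent_isAncestor hx0)⟩)
  refine ⟨t, fun x hx => ?_, ?_, fun i hi x hx hxc => ?_⟩
  · have := (ht x).1 hx
    simp only [hBdef, Finset.mem_filter] at this
    exact this.2.1
  · have hsub : B.erase c.1 ⊆
        Finset.univ.filter (fun x => I.IsAncestor x q ∧ ¬ I.IsAncestor x c.1) ∪
          K.biUnion fun i => I.detour c q (A i) := by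
      intro x hx
      simp only [hBdef, Finset.mem_erase, Finset.mem_filter, Finset.mem_univ, true_and] at hx
      obtain ⟨hxρ, hxc, hx⟩ := hx
      by_cases hxq : I.IsAncestor x q
      · refine Finset.mem_union_left _ (Finset.mem_filter.2 ⟨Finset.mem_univ _, hxq, fun h => ?_⟩)
        exact hxρ (h.antisymm (hc.isAncestor x hxc))
      · obtain ⟨i, hi, hxi⟩ := hx.resolve_left hxq
        exact Finset.mem_union_right _ (Finset.mem_biUnion.2
          ⟨i, hi, Finset.mem_filter.2 ⟨hxi, hxc, hxq⟩⟩)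
    have h1 : ∑ x ∈ B.erase c.1, I.parentWeight x ≤
        ∑ x ∈ Finset.univ.filter (fun x => I.IsAncestor x q ∧ ¬ I.IsAncestor x c.1),
          I.parentWeight x + ∑ i ∈ K, ∑ x ∈ I.detour c q (A i), I.parentWeight x := by
      refine (Finset.sum_le_sum_of_subset hsub).trans ?_
      refine le_trans ?_ (Nat.add_le_add_left (sum_biUnion_le K _ _) _)
      have := Finset.sum_union_inter
        (s₁ := Finset.univ.filter (fun x => I.IsAncestor x q ∧ ¬ I.IsAncestor x c.1))
        (s₂ := K.biUnion fun i => I.detour c q (A i)) (f := I.parentWeight)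
      omega
    have h2 := I.sum_ancestors_sdiff hρq
    have h3 : 2 * ∑ i ∈ K, ∑ x ∈ I.detour c q (A i), I.parentWeight x + 2 * I.dist I.root q ≤
        I.limit := by
      -- If the limit equals `2 * dist q`, division by zero makes every size 0 and `hK` says
      -- nothing. In this case `hD` forces the detours to have weight 0.
      rcases hDq.eq_or_lt with h | h
      · have h4 : ∑ i ∈ K, ∑ x ∈ I.detour c q (A i), I.parentWeight x = 0 :=
          Finset.sum_eq_zero fun i hi => by have := hD i hi; omega
        omega
      · have h4 : (0 : ℝ) < (I.limit : ℝ) - 2 * (I.dist I.root q : ℝ) := by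
          have : (2 : ℝ) * (I.dist I.root q : ℝ) < I.limit := by exact_mod_cast h
          linarith
        simp only [detourSize] at hK
        rw [← Finset.sum_div, div_le_one h4, ← Finset.mul_sum, ← Nat.cast_sum] at hK
        have h5 : 2 * ((∑ i ∈ K, ∑ x ∈ I.detour c q (A i), I.parentWeight x : ℕ) : ℝ) +
            2 * (I.dist I.root q : ℝ) ≤ I.limit := by linarith
        exact_mod_cast h5
    rw [hlen]
    omega
  · rw [ht]
    simp only [hBdef, Finset.mem_filter, Finset.mem_univ, true_and]
    exact ⟨hxc, Or.inr ⟨i, hi, hx⟩⟩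

open Classical in
/-- Packing the detours on the way to the same vertex into unit bins gives one tour for each bin. -/
theorem exists_combined_tours [Fintype V] {ι : Type*} {c : Component V} {e q : V} (hc : I.IsPiece c e)
    (hq : q ∈ c.2) (J : Finset ι) (A : ι → Finset V)
    (hA : ∀ i ∈ J, ∀ x ∈ A i, ∀ y, I.IsAncestor y x → y ∈ A i)
    (hD : ∀ i ∈ J, 2 * ∑ x ∈ I.detour c q (A i), I.parentWeight x + 2 * I.dist I.root q ≤ I.limit)
    (hDq : 2 * I.dist I.root q ≤ I.limit) (f : ι → ℕ)
    (hf : ∀ b, ∑ i ∈ J.filter (fun i => f i = b), I.detourSize c q (A i) ≤ 1) :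
    ∃ S : Finset (I.graph.Walk c.1 c.1), S.card ≤ (J.image f).card ∧
      (∀ t ∈ S, (∀ x ∈ t.support, x ∈ c.2) ∧
        (I.walkLength t : ℤ) ≤ (I.limit : ℤ) - 2 * (I.dist I.root c.1 : ℤ)) ∧
      ∀ i ∈ J, ∀ x ∈ A i, x ∈ c.2 → ∃ t ∈ S, x ∈ t.support := by
  have key := fun b => I.exists_combined_tour hc hq (J.filter fun i => f i = b) A
    (fun i hi => hA i (Finset.mem_filter.1 hi).1) (fun i hi => hD i (Finset.mem_filter.1 hi).1)
    hDq (hf b)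
  choose t ht1 ht2 ht3 using key
  refine ⟨(J.image f).image t, Finset.card_image_le, ?_, ?_⟩
  · intro s hs
    obtain ⟨b, -, rfl⟩ := Finset.mem_image.1 hs
    exact ⟨ht1 b, ht2 b⟩
  · intro i hi x hx hxc
    exact ⟨t (f i), Finset.mem_image_of_mem _ (Finset.mem_image_of_mem _ hi),
      ht3 (f i) i (by simp [hi]) x hx hxc⟩

/-- The components and their exit vertices: the edges are distributed among the components, and
components meet in roots and exit vertices only. -/
structure IsDecomposition (Cs : Finset (Component V)) (e : Component V → V) : Prop where
  isPiece : ∀ c ∈ Cs, I.IsPiece c (e c)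
  eq_of_mem : ∀ c ∈ Cs, ∀ c' ∈ Cs, ∀ x ∈ c.2, x ∈ c'.2 → x ≠ c.1 → x ≠ c'.1 → c = c'
  root_or_exit : ∀ c ∈ Cs, ∀ c' ∈ Cs, ∀ x ∈ c.2, x = c'.1 ∨ x = e c' → x = c.1 ∨ x = e c

/-! ### The share of each tour in each component -/

section

variable {I}
variable {Cs : Finset (Component V)} {e : Component V → V} {A : Finset V}

theorem IsPiece.pivot_mem {c : Component V} {e : V} (h : I.IsPiece c e) : pivot c e A ∈ c.2 := by
  unfold pivot
  split_ifs
  · exact h.exit_mem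
  · exact h.root_mem

/-- The root is an ancestor of the pivot. Hence components that share a root share no detour edge
there. -/
theorem IsPiece.detour_ne {c : Component V} {e x : V} (h : I.IsPiece c e)
    (hx : x ∈ I.detour c (pivot c e A) A) : x ≠ c.1 := by
  rintro rfl
  exact (mem_detour.1 hx).2.2 (h.isAncestor _ h.pivot_mem)

/-- A pivot outside `A` must be the root, and a tour that misses the root misses everything below
it. -/
theorem IsPiece.detour_eq_empty {c : Component V} {e : V} (h : I.IsPiece c e)
    (hA : ∀ x ∈ A, ∀ y, I.IsAncestor y x → y ∈ A) (hp : pivot c e A ∉ A) :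
    I.detour c (pivot c e A) A = ∅ := by
  refine Finset.eq_empty_of_forall_notMem fun x hx => ?_
  obtain ⟨hxA, hxc, -⟩ := mem_detour.1 hx
  have h1 := hA x hxA _ (h.isAncestor x hxc)
  unfold pivot at hp
  split_ifs at hp with h2
  · exact hp h2
  · exact hp h1

/-- If the pivot is reached, the detour and the way from the depot to the pivot are disjoint parts
of `A`. If it is not reached, the detour is empty and `hD` suffices. -/
theorem IsPiece.two_mul_detour_le [Fintype V] {c : Component V} {e : V} (h : I.IsPiece c e)
    (hA : ∀ x ∈ A, ∀ y, I.IsAncestor y x → y ∈ A)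
    (hlen : 2 * ∑ x ∈ A, I.parentWeight x ≤ I.limit)
    (hD : ∀ v, 2 * I.dist I.root v ≤ I.limit) :
    2 * ∑ x ∈ I.detour c (pivot c e A) A, I.parentWeight x +
      2 * I.dist I.root (pivot c e A) ≤ I.limit := by
  classical
  by_cases hp : pivot c e A ∈ A
  · have h1 : Disjoint (I.detour c (pivot c e A) A)
        (Finset.univ.filter fun x => I.IsAncestor x (pivot c e A)) := by
      rw [Finset.disjoint_left]
      intro x hx hx'
      exact (mem_detour.1 hx).2.2 (Finset.mem_filter.1 hx').2
    have h2 := Finset.sum_union (f := I.parentWeight) h1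
    rw [I.sum_ancestors] at h2
    have h3 : I.detour c (pivot c e A) A ∪
        (Finset.univ.filter fun x => I.IsAncestor x (pivot c e A)) ⊆ A := by
      refine Finset.union_subset (Finset.filter_subset _ _) fun x hx => ?_
      exact hA _ hp x (Finset.mem_filter.1 hx).2
    have h4 := Finset.sum_le_sum_of_subset (f := I.parentWeight) h3
    omega
  · rw [h.detour_eq_empty hA hp]
    simpa using hD _

/-- Needed so that the detours of a tour avoid the way to its farthest reached pivot. Suppose that a
detour edge `y` of `c` is above a reached pivot `x` of some component. If `x` were below the exit of
`c`, the exit would be reached too, and then `y` would lie at or above the exit, which is excluded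
for a detour. So `x` lies in `c`, where it can only be the root or the exit, and neither is
possible. -/
theorem IsDecomposition.not_isAncestor_of_mem_detour (h : I.IsDecomposition Cs e)
    (hA : ∀ x ∈ A, ∀ y, I.IsAncestor y x → y ∈ A) {c c' : Component V} (hc : c ∈ Cs) (hc' : c' ∈ Cs)
    (hp : pivot c' (e c') A ∈ A) {y : V} (hy : y ∈ I.detour c (pivot c (e c) A) A) :
    ¬ I.IsAncestor y (pivot c' (e c') A) := by
  intro hanc
  have hpc := h.isPiece c hc
  have hyρ := hpc.detour_ne hy
  obtain ⟨hyA, hyc, hyp⟩ := mem_detour.1 hy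
  set x := pivot c' (e c') A with hx
  have hx' : x = c'.1 ∨ x = e c' := by
    rw [hx]; unfold pivot; split_ifs <;> simp
  have hex : e c ≠ c.1 → ¬ I.IsAncestor (e c) x := by
    intro hne hex
    by_cases heA : e c ∈ A
    · rw [pivot, if_pos heA] at hyp
      rcases hanc.total hex with h1 | h1
      · exact hyp h1
      · exact hyp (hpc.eq_exit hne y hyc h1 ▸ I.isAncestor_refl _)
    · exact heA (hA x hp _ hex)
  have hxc := hpc.mem_of_isAncestor y hyc hyρ x hanc hex
  have hxρ : x ≠ c.1 := fun hxρ => hyρ ((hxρ ▸ hanc).antisymm (hpc.isAncestor y hyc))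
  rcases h.root_or_exit c hc c' hc' x hxc hx' with h1 | h1
  · exact hxρ h1
  · exact hex (h1 ▸ hxρ) (h1 ▸ I.isAncestor_refl _)

/-- The detours of one tour in all components fit into a unit bin. -/
theorem IsDecomposition.sum_detourSize_le_one [Fintype V] (h : I.IsDecomposition Cs e)
    (hA : ∀ x ∈ A, ∀ y, I.IsAncestor y x → y ∈ A)
    (hlen : 2 * ∑ x ∈ A, I.parentWeight x ≤ I.limit) :
    ∑ c ∈ Cs, I.detourSize c (pivot c (e c) A) A ≤ 1 := by
  classical
  set Cs' := Cs.filter fun c => pivot c (e c) A ∈ A with hCs'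
  have hsum : ∑ c ∈ Cs, I.detourSize c (pivot c (e c) A) A =
      ∑ c ∈ Cs', I.detourSize c (pivot c (e c) A) A := by
    rw [hCs', Finset.sum_filter]
    refine Finset.sum_congr rfl fun c hc => ?_
    split_ifs with hp
    · rfl
    · rw [detourSize, (h.isPiece c hc).detour_eq_empty hA hp]; simp
  rw [hsum]
  rcases Cs'.eq_empty_or_nonempty with hemp | hne
  · rw [hemp]; simp
  -- The reached pivot farthest from the depot has the smallest denominator, which may replace all
  -- the others.
  obtain ⟨c₀, hc₀, hmax⟩ := Finset.exists_max_image Cs'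
    (fun c => I.dist I.root (pivot c (e c) A)) hne
  obtain ⟨hc₀C, hc₀A⟩ := Finset.mem_filter.1 hc₀
  set q := pivot c₀ (e c₀) A with hq
  have hdisj : (Cs' : Set (Component V)).PairwiseDisjoint
      fun c => I.detour c (pivot c (e c) A) A := by
    intro c hc c' hc' hcc
    have hc := (Finset.mem_filter.1 hc).1
    have hc' := (Finset.mem_filter.1 hc').1
    refine Finset.disjoint_left.2 fun x hx hx' => hcc ?_
    exact h.eq_of_mem c hc c' hc' x (mem_detour.1 hx).2.1 (mem_detour.1 hx').2.1
      ((h.isPiece c hc).detour_ne hx) ((h.isPiece c' hc').detour_ne hx')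
  have h1 : Disjoint (Cs'.biUnion fun c => I.detour c (pivot c (e c) A) A)
      (Finset.univ.filter fun x => I.IsAncestor x q) := by
    refine Finset.disjoint_left.2 fun x hx hx' => ?_
    obtain ⟨c, hc, hx⟩ := Finset.mem_biUnion.1 hx
    exact h.not_isAncestor_of_mem_detour hA (Finset.mem_filter.1 hc).1 hc₀C hc₀A hx
      (Finset.mem_filter.1 hx').2
  have h2 := Finset.sum_union (f := I.parentWeight) h1
  rw [I.sum_ancestors, Finset.sum_biUnion hdisj] at h2
  have h3 : (Cs'.biUnion fun c => I.detour c (pivot c (e c) A) A) ∪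
      (Finset.univ.filter fun x => I.IsAncestor x q) ⊆ A := by
    refine Finset.union_subset (Finset.biUnion_subset.2 fun c _ => Finset.filter_subset _ _)
      fun x hx => ?_
    exact hA _ hc₀A x (Finset.mem_filter.1 hx).2
  have h4 := Finset.sum_le_sum_of_subset (f := I.parentWeight) h3
  have h5 : 2 * ∑ c ∈ Cs', ∑ x ∈ I.detour c (pivot c (e c) A) A, I.parentWeight x +
      2 * I.dist I.root q ≤ I.limit := by omega
  -- If the common denominator vanishes, so do all detour weights, and the sum of the sizes is 0.
  rcases (show 2 * I.dist I.root q ≤ I.limit by omega).eq_or_lt with h6 | h6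
  · have h7 : ∀ c ∈ Cs', ∑ x ∈ I.detour c (pivot c (e c) A) A, I.parentWeight x = 0 :=
      Finset.sum_eq_zero_iff.1 (by omega)
    rw [Finset.sum_eq_zero fun c hc => by rw [detourSize, h7 c hc]; simp]
    exact zero_le_one
  · have h7 : (0 : ℝ) < (I.limit : ℝ) - 2 * (I.dist I.root q : ℝ) := by
      have : (2 : ℝ) * (I.dist I.root q : ℝ) < I.limit := by exact_mod_cast h6
      linarith
    calc ∑ c ∈ Cs', I.detourSize c (pivot c (e c) A) A
        ≤ ∑ c ∈ Cs', 2 * ((∑ x ∈ I.detour c (pivot c (e c) A) A, I.parentWeight x : ℕ) : ℝ) /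
            ((I.limit : ℝ) - 2 * (I.dist I.root q : ℝ)) := by
          refine Finset.sum_le_sum fun c hc => ?_
          have h8 : (I.dist I.root (pivot c (e c) A) : ℝ) ≤ I.dist I.root q := by
            exact_mod_cast hmax c hc
          exact div_le_div_of_nonneg_left (by positivity) h7 (by linarith)
      _ ≤ 1 := by
          rw [← Finset.sum_div, div_le_one h7, ← Finset.mul_sum, ← Nat.cast_sum]
          have h8 : 2 * ((∑ c ∈ Cs', ∑ x ∈ I.detour c (pivot c (e c) A) A,
              I.parentWeight x : ℕ) : ℝ) + 2 * (I.dist I.root q : ℝ) ≤ I.limit := by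
            exact_mod_cast h5
          linarith

theorem IsPiece.detourSize_le_one {c : Component V} {e : V} [Fintype V] (h : I.IsPiece c e)
    (hA : ∀ x ∈ A, ∀ y, I.IsAncestor y x → y ∈ A)
    (hlen : 2 * ∑ x ∈ A, I.parentWeight x ≤ I.limit)
    (hD : ∀ v, 2 * I.dist I.root v ≤ I.limit) : I.detourSize c (pivot c e A) A ≤ 1 := by
  have h1 := h.two_mul_detour_le hA hlen hD
  have h2 : 2 * ((∑ x ∈ I.detour c (pivot c e A) A, I.parentWeight x : ℕ) : ℝ) +
      2 * (I.dist I.root (pivot c e A) : ℝ) ≤ I.limit := by exact_mod_cast h1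
  exact div_le_one_of_le₀ (by linarith) (by
    have : (0 : ℝ) ≤ ((∑ x ∈ I.detour c (pivot c e A) A, I.parentWeight x : ℕ) : ℝ) :=
      Nat.cast_nonneg _
    linarith)

open Classical in
/-- Unit bins for the detours of the tours that reach the exit vertex, and for the detours of the
other tours, give tours that serve the component. -/
theorem IsPiece.exists_isFeasible [Fintype V] {ι : Type*} {c : Component V} {e : V}
    (h : I.IsPiece c e) (T : Finset ι) (A : ι → Finset V)
    (hA : ∀ i ∈ T, ∀ x ∈ A i, ∀ y, I.IsAncestor y x → y ∈ A i)
    (hlen : ∀ i ∈ T, 2 * ∑ x ∈ A i, I.parentWeight x ≤ I.limit)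
    (hD : ∀ v, 2 * I.dist I.root v ≤ I.limit)
    (hcov : ∀ u ∈ I.terminals, u ∈ c.2 → ∃ i ∈ T, u ∈ A i) (f g : ι → ℕ)
    (hf : ∀ b, ∑ i ∈ (T.filter fun i => e ∈ A i).filter (fun i => f i = b),
      I.detourSize c e (A i) ≤ 1)
    (hg : ∀ b, ∑ i ∈ (T.filter fun i => e ∉ A i).filter (fun i => g i = b),
      I.detourSize c c.1 (A i) ≤ 1) :
    ∃ S, I.IsFeasible c.1 c.2 ((I.limit : ℤ) - 2 * (I.dist I.root c.1 : ℤ)) S ∧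
      S.card ≤ ((T.filter fun i => e ∈ A i).image f).card +
        ((T.filter fun i => e ∉ A i).image g).card := by
  obtain ⟨S₁, hc₁, hS₁, hv₁⟩ := I.exists_combined_tours h h.exit_mem
    (T.filter fun i => e ∈ A i) A (fun i hi => hA i (Finset.mem_filter.1 hi).1)
    (fun i hi => by
      obtain ⟨hi, he⟩ := Finset.mem_filter.1 hi
      have := h.two_mul_detour_le (hA i hi) (hlen i hi) hD
      rwa [pivot, if_pos he] at this) (hD _) f hf
  obtain ⟨S₂, hc₂, hS₂, hv₂⟩ := I.exists_combined_tours h h.root_mem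
    (T.filter fun i => e ∉ A i) A (fun i hi => hA i (Finset.mem_filter.1 hi).1)
    (fun i hi => by
      obtain ⟨hi, he⟩ := Finset.mem_filter.1 hi
      have := h.two_mul_detour_le (hA i hi) (hlen i hi) hD
      rwa [pivot, if_neg he] at this) (hD _) g hg
  refine ⟨S₁ ∪ S₂, ⟨fun t ht => ?_, fun u hu huc => ?_⟩,
    (Finset.card_union_le _ _).trans (Nat.add_le_add hc₁ hc₂)⟩
  · rcases Finset.mem_union.1 ht with ht | ht
    · exact hS₁ t ht
    · exact hS₂ t ht
  · obtain ⟨i, hi, hui⟩ := hcov u hu huc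
    by_cases he : e ∈ A i
    · obtain ⟨t, ht, hut⟩ := hv₁ i (Finset.mem_filter.2 ⟨hi, he⟩) u hui huc
      exact ⟨t, Finset.mem_union_left _ ht, hut⟩
    · obtain ⟨t, ht, hut⟩ := hv₂ i (Finset.mem_filter.2 ⟨hi, he⟩) u hui huc
      exact ⟨t, Finset.mem_union_right _ ht, hut⟩

open Classical in
theorem sum_pivot_eq {ι : Type*} (T : Finset ι) (A : ι → Finset V) (c : Component V) (e : V) :
    ∑ i ∈ T, I.detourSize c (pivot c e (A i)) (A i) =
      ∑ i ∈ T.filter (fun i => e ∈ A i), I.detourSize c e (A i) +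
        ∑ i ∈ T.filter (fun i => e ∉ A i), I.detourSize c c.1 (A i) := by
  rw [← Finset.sum_filter_add_sum_filter_not T fun i => e ∈ A i]
  congr 1
  · exact Finset.sum_congr rfl fun i hi => by rw [pivot, if_pos (Finset.mem_filter.1 hi).2]
  · exact Finset.sum_congr rfl fun i hi => by rw [pivot, if_neg (Finset.mem_filter.1 hi).2]

/-- Serving all components needs little more than a bounded-space packing of the detours. -/
theorem IsDecomposition.exists_card_le [Fintype V] {ι : Type*} (h : I.IsDecomposition Cs e)
    (T : Finset ι) (A : ι → Finset V)
    (hA : ∀ i ∈ T, ∀ x ∈ A i, ∀ y, I.IsAncestor y x → y ∈ A i)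
    (hlen : ∀ i ∈ T, 2 * ∑ x ∈ A i, I.parentWeight x ≤ I.limit)
    (hD : ∀ v, 2 * I.dist I.root v ≤ I.limit)
    (hcov : ∀ u ∈ I.terminals, ∃ i ∈ T, u ∈ A i) {M : ℕ} {β γ : ℝ} (hβ : 0 ≤ β)
    (hBP : ∀ items : List ℝ, (∀ a ∈ items, a ∈ Set.Icc (0 : ℝ) 1) →
      ∃ s : BinState, BinRun M items s ∧ (s.opened : ℝ) ≤ β * (optBinPacking items : ℝ) + γ) :
    ∃ n : Component V → ℕ, (∀ c ∈ Cs, ∃ S,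
        I.IsFeasible c.1 c.2 ((I.limit : ℤ) - 2 * (I.dist I.root c.1 : ℤ)) S ∧ S.card ≤ n c) ∧
      ((∑ c ∈ Cs, n c : ℕ) : ℝ) ≤ β * T.card + γ + 2 * M * Cs.card := by
  classical
  -- Only detours with the same pivot can be merged, so each component gives two groups, for the
  -- tours that reach the exit and for those that do not. This is the factor 2 in `2 * M * Cs.card`.
  obtain ⟨f, hf, hsum⟩ := exists_grouped_packing hβ hBP (Cs ×ˢ (Finset.univ : Finset Bool))
    (fun g => if g.2 then T.filter (fun i => e g.1 ∈ A i) else T.filter (fun i => e g.1 ∉ A i))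
    (fun g i => I.detourSize g.1 (if g.2 then e g.1 else g.1.1) (A i)) T
    (fun g _ i _ => I.detourSize_nonneg (hD _))
    (fun g _ => by split_ifs <;> exact Finset.filter_subset _ _)
    (fun t ht => by
      refine le_of_eq_of_le ?_ (h.sum_detourSize_le_one (hA t ht) (hlen t ht))
      rw [Finset.sum_filter, Finset.sum_product]
      refine Finset.sum_congr rfl fun c _ => ?_
      by_cases he : e c ∈ A t <;> simp [pivot, he, ht])
  refine ⟨fun c => ((T.filter fun i => e c ∈ A i).image (f (c, true))).card +
    ((T.filter fun i => e c ∉ A i).image (f (c, false))).card, fun c hc => ?_, ?_⟩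
  · exact (h.isPiece c hc).exists_isFeasible T A hA hlen hD (fun u hu _ => hcov u hu) _ _
      (by simpa using hf (c, true) (by simp [hc])) (by simpa using hf (c, false) (by simp [hc]))
  · refine le_of_eq_of_le ?_ (hsum.trans_eq ?_)
    · rw [Finset.sum_product]
      simp
    · rw [Finset.card_product]
      simp; ring

/-- Serving a component needs at most two tours more than twice the share of a solution that belongs
to it. -/
theorem IsDecomposition.exists_share [Fintype V] {ι : Type*} (h : I.IsDecomposition Cs e)
    (T : Finset ι) (A : ι → Finset V)
    (hA : ∀ i ∈ T, ∀ x ∈ A i, ∀ y, I.IsAncestor y x → y ∈ A i)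
    (hlen : ∀ i ∈ T, 2 * ∑ x ∈ A i, I.parentWeight x ≤ I.limit)
    (hD : ∀ v, 2 * I.dist I.root v ≤ I.limit)
    (hcov : ∀ u ∈ I.terminals, ∃ i ∈ T, u ∈ A i) :
    ∃ σ : Component V → ℝ, (∀ c ∈ Cs, 0 ≤ σ c ∧ ∃ S,
        I.IsFeasible c.1 c.2 ((I.limit : ℤ) - 2 * (I.dist I.root c.1 : ℤ)) S ∧
          (S.card : ℝ) ≤ 2 * σ c + 2) ∧ ∑ c ∈ Cs, σ c ≤ T.card := by
  classical
  refine ⟨fun c => ∑ i ∈ T, I.detourSize c (pivot c (e c) (A i)) (A i), fun c hc => ⟨?_, ?_⟩, ?_⟩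
  · exact Finset.sum_nonneg fun i _ => I.detourSize_nonneg (hD _)
  · have hle := fun i hi => (h.isPiece c hc).detourSize_le_one (hA i hi) (hlen i hi) hD
    -- The two pivots are packed separately, and each greedy packing costs one additional bin.
    obtain ⟨f, hf, hfc⟩ := exists_packing (T.filter fun i => e c ∈ A i)
      (fun i => I.detourSize c (e c) (A i)) (fun i _ => I.detourSize_nonneg (hD _))
      (fun i hi => by
        obtain ⟨hi, he⟩ := Finset.mem_filter.1 hi
        have := hle i hi
        rwa [pivot, if_pos he] at this)
    obtain ⟨g, hg, hgc⟩ := exists_packing (T.filter fun i => e c ∉ A i)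
      (fun i => I.detourSize c c.1 (A i)) (fun i _ => I.detourSize_nonneg (hD _))
      (fun i hi => by
        obtain ⟨hi, he⟩ := Finset.mem_filter.1 hi
        have := hle i hi
        rwa [pivot, if_neg he] at this)
    obtain ⟨S, hS, hcard⟩ := (h.isPiece c hc).exists_isFeasible T A hA hlen hD
      (fun u hu _ => hcov u hu) f g hf hg
    refine ⟨S, hS, ?_⟩
    beta_reduce
    rw [sum_pivot_eq]
    have : (S.card : ℝ) ≤ ((T.filter fun i => e c ∈ A i).image f).card +
        ((T.filter fun i => e c ∉ A i).image g).card := by exact_mod_cast hcard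
    linarith
  · rw [Finset.sum_comm]
    refine (Finset.sum_le_sum fun i hi =>
      h.sum_detourSize_le_one (hA i hi) (hlen i hi)).trans ?_
    simp

end

end TreeDVRP

namespace TreeDVRP

variable {V : Type*} (I : TreeDVRP V)

/-! ### Serving components -/

/-- The tours in `S` serve the component `c`. -/
abbrev Serves (c : Component V) (S : Finset (I.graph.Walk c.1 c.1)) : Prop :=
  I.IsFeasible c.1 c.2 ((I.limit : ℤ) - 2 * (I.dist I.root c.1 : ℤ)) S

variable {I}

theorem Serves.solve_le {Γ : ℝ} {c : Component V} {S : Finset (I.graph.Walk c.1 c.1)}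
    (hS : I.Serves c S) (hΓ : (S.card : ℝ) ≤ Γ) : I.solve Γ c ≤ S.card :=
  sInf_le ⟨S, hS, hΓ, rfl⟩

theorem Serves.solvable {Γ : ℝ} {c : Component V} {S : Finset (I.graph.Walk c.1 c.1)}
    (hS : I.Serves c S) (hΓ : (S.card : ℝ) ≤ Γ) : I.Solvable Γ c :=
  ne_top_of_le_ne_top (ENat.natCast_ne_top _) (hS.solve_le hΓ)

theorem Solvable.exists_serves {Γ : ℝ} {c : Component V} (h : I.Solvable Γ c) :
    ∃ S, I.Serves c S ∧ (S.card : ℝ) ≤ Γ ∧ I.solve Γ c = S.card := by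
  have hne : {n : ℕ∞ | ∃ S : Finset (I.graph.Walk c.1 c.1),
      I.IsFeasible c.1 c.2 ((I.limit : ℤ) - 2 * (I.dist I.root c.1 : ℤ)) S ∧
        (S.card : ℝ) ≤ Γ ∧ n = (S.card : ℕ∞)}.Nonempty := by
    by_contra hemp
    rw [Set.not_nonempty_iff_eq_empty] at hemp
    exact h (by rw [solve, hemp, sInf_empty])
  obtain ⟨S, h1, h2, h3⟩ := csInf_mem hne
  exact ⟨S, h1, h2, h3⟩

/-- The cap `Γ` is irrelevant once some solution respects it: a solution with more than `Γ` tours is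
larger than that one. -/
theorem Solvable.solve_le {Γ : ℝ} {c : Component V} (h : I.Solvable Γ c)
    {S : Finset (I.graph.Walk c.1 c.1)} (hS : I.Serves c S) : I.solve Γ c ≤ S.card := by
  by_cases hΓ : (S.card : ℝ) ≤ Γ
  · exact hS.solve_le hΓ
  · obtain ⟨S', -, h2, h3⟩ := h.exists_serves
    rw [h3]
    have : (S'.card : ℝ) ≤ S.card := by linarith
    exact_mod_cast this

/-- Extending tours from a child to its parent. -/
theorem Serves.exists_lift {p v : V} {C : Set V} {S : Finset (I.graph.Walk v v)}
    (hS : I.Serves (v, C) S) (h : I.IsChild p v) :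
    ∃ S' : Finset (I.graph.Walk p p), S'.card ≤ S.card ∧
      (∀ t ∈ S', (∀ x ∈ t.support, x = p ∨ x ∈ C) ∧
        (I.walkLength t : ℤ) ≤ (I.limit : ℤ) - 2 * (I.dist I.root p : ℤ)) ∧
      ∀ u ∈ I.terminals, u ∈ C → ∃ t ∈ S', u ∈ t.support := by
  classical
  refine ⟨S.image fun t => .cons h.1 (t.concat h.1.symm), Finset.card_image_le, ?_, ?_⟩
  · intro s hs
    obtain ⟨t, ht, rfl⟩ := Finset.mem_image.1 hs
    obtain ⟨h1, h2⟩ := hS.1 t ht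
    constructor
    · intro x hx
      simp only [SimpleGraph.Walk.support_cons, SimpleGraph.Walk.support_concat, List.mem_cons,
        List.mem_append] at hx
      rcases hx with hx | hx | hx
      · exact Or.inl hx
      · exact Or.inr (h1 x hx)
      · simp at hx; exact Or.inl hx
    · have h3 := h.dist_root
      rw [walkLength_cons, walkLength_concat, Sym2.eq_swap (a := v)]
      simp only at h2
      omega
  · intro u hu huC
    obtain ⟨t, ht, hut⟩ := hS.2 u hu huC
    refine ⟨_, Finset.mem_image_of_mem _ ht, ?_⟩
    simp [SimpleGraph.Walk.support_concat, hut]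

/-- Solutions for two children combine. -/
theorem Serves.exists_union {p v v' : V} {C C' D : Set V} {S : Finset (I.graph.Walk v v)}
    {S' : Finset (I.graph.Walk v' v')} (hS : I.Serves (v, C) S) (hS' : I.Serves (v', C') S')
    (h : I.IsChild p v) (h' : I.IsChild p v') (hp : p ∈ D) (hC : C ⊆ D) (hC' : C' ⊆ D)
    (hD : ∀ u ∈ I.terminals, u ∈ D → u ∈ C ∨ u ∈ C') :
    ∃ R, I.Serves (p, D) R ∧ R.card ≤ S.card + S'.card := by
  classical
  obtain ⟨R, hR, hR1, hR2⟩ := hS.exists_lift h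
  obtain ⟨R', hR', hR1', hR2'⟩ := hS'.exists_lift h'
  refine ⟨R ∪ R', ⟨fun t ht => ?_, fun u hu huD => ?_⟩,
    (Finset.card_union_le _ _).trans (Nat.add_le_add hR hR')⟩
  · rcases Finset.mem_union.1 ht with ht | ht
    · refine ⟨fun x hx => ?_, (hR1 t ht).2⟩
      rcases (hR1 t ht).1 x hx with rfl | hx
      · exact hp
      · exact hC hx
    · refine ⟨fun x hx => ?_, (hR1' t ht).2⟩
      rcases (hR1' t ht).1 x hx with rfl | hx
      · exact hp
      · exact hC' hx
  · rcases hD u hu huD with hu' | hu'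
    · obtain ⟨t, ht, hut⟩ := hR2 u hu hu'
      exact ⟨t, Finset.mem_union_left _ ht, hut⟩
    · obtain ⟨t, ht, hut⟩ := hR2' u hu hu'
      exact ⟨t, Finset.mem_union_right _ ht, hut⟩

/-- Extending tours to the depot. -/
theorem Serves.exists_root_tours {c : Component V} {S : Finset (I.graph.Walk c.1 c.1)}
    (hS : I.Serves c S) :
    ∃ R : Finset (I.graph.Walk I.root I.root), R.card ≤ S.card ∧
      (∀ t ∈ R, (I.walkLength t : ℤ) ≤ I.limit) ∧
      ∀ u ∈ I.terminals, u ∈ c.2 → ∃ t ∈ R, u ∈ t.support := by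
  classical
  refine ⟨S.image fun t => (I.path c.1).append (t.append (I.path c.1).reverse),
    Finset.card_image_le, ?_, ?_⟩
  · intro s hs
    obtain ⟨t, ht, rfl⟩ := Finset.mem_image.1 hs
    have h2 := (hS.1 t ht).2
    rw [I.dist_root_eq] at h2
    simp only [walkLength_append, walkLength_reverse]
    omega
  · intro u hu huC
    obtain ⟨t, ht, hut⟩ := hS.2 u hu huC
    refine ⟨_, Finset.mem_image_of_mem _ ht, ?_⟩
    simp [SimpleGraph.Walk.mem_support_append_iff, hut]

theorem mem_below {v x : V} : x ∈ (I.below v).2 ↔ I.IsAncestor v x := Iff.rfl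

theorem IsNormalized.mem_terminals (hI : I.IsNormalized) {v : V} :
    v ∈ I.terminals ↔ ∀ u, ¬ I.IsChild v u := by rw [hI.2]; rfl

theorem IsNormalized.exists_children (hI : I.IsNormalized) {v u : V} (h : I.IsChild v u) :
    ∃ u', I.IsChild v u' ∧ u ≠ u' ∧ ∀ w, I.IsChild v w → w = u ∨ w = u' := by
  rcases hI.1 v with h0 | h2
  · exact absurd h (Set.eq_empty_iff_forall_notMem.1 h0 u)
  · obtain ⟨x, y, hxy, hset⟩ := Set.ncard_eq_two.1 h2
    have hw : ∀ w, I.IsChild v w ↔ w = x ∨ w = y := fun w => by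
      have := Set.ext_iff.1 hset w
      simpa using this
    rcases (hw u).1 h with rfl | rfl
    · exact ⟨y, (hw y).2 (Or.inr rfl), hxy, fun w hw' => (hw w).1 hw'⟩
    · exact ⟨x, (hw x).2 (Or.inl rfl), hxy.symm, fun w hw' => ((hw w).1 hw').symm⟩

theorem IsNormalized.exists_terminal [Finite V] (hI : I.IsNormalized) (v : V) :
    ∃ u ∈ I.terminals, I.IsAncestor v u := by
  induction v using I.descendant_induction with
  | h v ih =>
    by_cases hv : v ∈ I.terminals
    · exact ⟨v, hv, I.isAncestor_refl v⟩
    · rw [hI.mem_terminals] at hv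
      push Not at hv
      obtain ⟨w, hw⟩ := hv
      obtain ⟨u, hu, hwu⟩ := ih w hw
      exact ⟨u, hu, hw.isAncestor.trans hwu⟩

/-- There is a terminal below `v`, and a tour visiting it traverses every edge above `v` at least
twice. -/
theorem two_mul_dist_le_of_isFeasible [Finite V] (hI : I.IsNormalized)
    {S : Finset (I.graph.Walk I.root I.root)} (hS : I.IsFeasible I.root Set.univ I.limit S)
    (v : V) : 2 * I.dist I.root v ≤ I.limit := by
  classical
  cases nonempty_fintype V
  obtain ⟨u, hu, hvu⟩ := hI.exists_terminal v
  obtain ⟨t, ht, hut⟩ := hS.2 u hu (Set.mem_univ u)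
  have h1 := I.two_mul_sum_le_walkLength t
  have h2 : (I.walkLength t : ℤ) ≤ I.limit := (hS.1 t ht).2
  rw [← I.sum_ancestors v]
  have h3 : Finset.univ.filter (fun x => I.IsAncestor x v) ⊆ t.support.toFinset := by
    intro x hx
    exact List.mem_toFinset.2 (((Finset.mem_filter.1 hx).2.trans hvu).mem_support hut)
  have h4 := Finset.sum_le_sum_of_subset (f := I.parentWeight) h3
  omega

/-- A leaf is served by the tour that does not leave it. -/
theorem exists_serves_terminal (hI : I.IsNormalized) {v : V} (hv : v ∈ I.terminals)
    (hD : 2 * I.dist I.root v ≤ I.limit) : ∃ S, I.Serves (I.below v) S ∧ S.card = 1 := by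
  refine ⟨{.nil}, ⟨?_, ?_⟩, Finset.card_singleton _⟩
  · intro t ht
    rw [Finset.mem_singleton.1 ht]
    refine ⟨fun x hx => ?_, ?_⟩
    · simp only [SimpleGraph.Walk.support_nil, List.mem_singleton] at hx
      rw [hx]
      exact I.isAncestor_refl v
    · simp only [walkLength_nil, below]
      omega
  · intro u _ hu
    refine ⟨.nil, Finset.mem_singleton_self _, ?_⟩
    by_cases huv : v = u
    · subst huv; simp [below]
    · obtain ⟨w, hw, -⟩ := (mem_below.1 hu).exists_child huv
      exact absurd hw (hI.mem_terminals.1 hv w)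

theorem serves_below_union (hI : I.IsNormalized) {p v v' : V} {S : Finset (I.graph.Walk v v)}
    {S' : Finset (I.graph.Walk v' v')} (hS : I.Serves (I.below v) S)
    (hS' : I.Serves (I.below v') S') (h : I.IsChild p v) (h' : I.IsChild p v')
    (hw : ∀ w, I.IsChild p w → w = v ∨ w = v') :
    ∃ R, I.Serves (I.below p) R ∧ R.card ≤ S.card + S'.card := by
  refine Serves.exists_union hS hS' h h' (I.isAncestor_refl p)
    (fun x hx => h.isAncestor.trans hx) (fun x hx => h'.isAncestor.trans hx) fun u hu hpu => ?_
  have hne : p ≠ u := by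
    rintro rfl
    exact hI.mem_terminals.1 hu v h
  obtain ⟨w, hpw, hwu⟩ := IsAncestor.exists_child hpu hne
  rcases hw w hpw with rfl | rfl
  · exact Or.inl hwu
  · exact Or.inr hwu

/-! ### Leaf components and the backbone -/

variable {Γ : ℝ}

theorem IsLeafRoot.eq_of_isAncestor {v w : V} (hv : I.IsLeafRoot Γ v) (hw : I.IsLeafRoot Γ w)
    (h : I.IsAncestor v w) : v = w := by
  by_contra hne
  exact hw.2 v h hne hv.1

theorem IsLeafRoot.eq_of_isAncestor_of_isAncestor {v w x : V} (hv : I.IsLeafRoot Γ v)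
    (hw : I.IsLeafRoot Γ w) (h : I.IsAncestor v x) (h' : I.IsAncestor w x) : v = w := by
  rcases h.total h' with h1 | h1
  · exact hv.eq_of_isAncestor hw h1
  · exact (hw.eq_of_isAncestor hv h1).symm

theorem IsLeafCandidate.exists_isLeafRoot {v : V} (hv : I.IsLeafCandidate Γ v) :
    ∃ w, I.IsLeafRoot Γ w ∧ I.IsAncestor w v := by
  obtain ⟨w, ⟨hw, hwv⟩, hmin⟩ := exists_minimal_depth (I := I)
    (P := fun w => I.IsLeafCandidate Γ w ∧ I.IsAncestor w v) ⟨v, hv, I.isAncestor_refl v⟩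
  refine ⟨w, ⟨hw, fun u hu hne hcand => ?_⟩, hwv⟩
  exact absurd (hu.depth_lt hne) (not_lt.2 (hmin u ⟨hcand, hu.trans hwv⟩))

theorem mem_backbone_of_isAncestor {x y : V} (hx : x ∈ I.backbone Γ) (h : I.IsAncestor y x) :
    y ∈ I.backbone Γ := by
  rcases hx with rfl | ⟨v, hv, hxv⟩
  · exact Or.inl (I.isAncestor_root_iff.1 h)
  · exact Or.inr ⟨v, hv, h.trans hxv⟩

theorem IsLeafRoot.mem_backbone {v : V} (hv : I.IsLeafRoot Γ v) : v ∈ I.backbone Γ :=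
  Or.inr ⟨v, hv, I.isAncestor_refl v⟩

theorem exists_isLeafRoot_of_mem_backbone {x : V} (hx : x ∈ I.backbone Γ) (h : x ≠ I.root) :
    ∃ v, I.IsLeafRoot Γ v ∧ I.IsAncestor x v := hx.resolve_left h

/-- The situation in which the whole tree is not a leaf component. -/
structure IsLarge (I : TreeDVRP V) (Γ : ℝ) : Prop where
  normalized : I.IsNormalized
  le_gamma : 20 ≤ Γ
  two_mul_dist_le : ∀ v, 2 * I.dist I.root v ≤ I.limit
  not_solvable_root : ¬ I.Solvable Γ (I.below I.root)

/-! ### Leaf components when the whole tree is unsolvable -/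

namespace IsLarge

theorem leafRoot_ne_root (h : I.IsLarge Γ) {v : V} (hv : I.IsLeafRoot Γ v) : v ≠ I.root := by
  rintro rfl
  exact h.not_solvable_root hv.1.1

theorem le_card_of_leafRoot (h : I.IsLarge Γ) {v : V} (hv : I.IsLeafRoot Γ v) {S : Finset (I.graph.Walk (I.below v).1 (I.below v).1)}
    (hS : I.Serves (I.below v) S) : Γ / 2 ≤ S.card := by
  have h1 := hv.1.2.resolve_left (h.leafRoot_ne_root hv)
  obtain ⟨S', -, -, h4⟩ := hv.1.1.exists_serves
  refine (h1 _ h4).trans ?_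
  have := hv.1.1.solve_le hS
  rw [h4] at this
  exact_mod_cast this

/-- A leaf is served by one tour, whereas a leaf component needs at least `Γ / 2 ≥ 10` tours. -/
theorem leafRoot_notMem_terminals (h : I.IsLarge Γ) {v : V} (hv : I.IsLeafRoot Γ v) : v ∉ I.terminals := by
  intro hvt
  obtain ⟨S, hS, hcard⟩ := exists_serves_terminal h.normalized hvt (h.two_mul_dist_le v)
  have h1 := h.le_card_of_leafRoot hv hS
  rw [hcard] at h1
  have := h.le_gamma
  norm_num at h1
  linarith

theorem notMem_terminals (h : I.IsLarge Γ) {x : V} (hx : x ∈ I.backbone Γ) (hne : x ≠ I.root) :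
    x ∉ I.terminals := by
  obtain ⟨v, hv, hxv⟩ := exists_isLeafRoot_of_mem_backbone hx hne
  by_cases hxv' : x = v
  · exact hxv' ▸ h.leafRoot_notMem_terminals hv
  · obtain ⟨w, hw, -⟩ := hxv.exists_child hxv'
    exact fun hxt => h.normalized.mem_terminals.1 hxt w hw

/-- Descend from `x`. A solvable subtree that needs at least `Γ / 2` tours is a candidate. An
unsolvable subtree has a child that needs at least `Γ / 2` tours, since otherwise the solutions for
both children would combine to fewer than `Γ` tours. -/
theorem exists_isLeafCandidate [Finite V] (h : I.IsLarge Γ) (x : V)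
    (hx : ¬ ∃ S, I.Serves (I.below x) S ∧ (S.card : ℝ) < Γ / 2) :
    ∃ v, I.IsLeafCandidate Γ v ∧ I.IsAncestor x v := by
  have hΓ := h.le_gamma
  induction x using I.descendant_induction with
  | h x ih =>
    by_cases hsolv : I.Solvable Γ (I.below x)
    · refine ⟨x, ⟨hsolv, Or.inr fun n hn => ?_⟩, I.isAncestor_refl x⟩
      obtain ⟨S, hS, -, hS3⟩ := hsolv.exists_serves
      rw [hn] at hS3
      have hS3 : n = S.card := by exact_mod_cast hS3
      by_contra hlt
      exact hx ⟨S, hS, by rw [← hS3]; exact not_le.1 hlt⟩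
    · have hxt : x ∉ I.terminals := fun hxt => by
        obtain ⟨S, hS, hcard⟩ := exists_serves_terminal h.normalized hxt (h.two_mul_dist_le x)
        exact hsolv (hS.solvable (by rw [hcard]; norm_num; linarith))
      rw [h.normalized.mem_terminals] at hxt
      push Not at hxt
      obtain ⟨u, hu⟩ := hxt
      obtain ⟨u', hu', -, hall⟩ := h.normalized.exists_children hu
      by_contra hcon
      have hsmall : ∀ w, I.IsChild x w → ∃ S, I.Serves (I.below w) S ∧ (S.card : ℝ) < Γ / 2 := by
        intro w hw
        by_contra hw'
        obtain ⟨v, hv, hwv⟩ := ih w hw hw'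
        exact hcon ⟨v, hv, hw.isAncestor.trans hwv⟩
      obtain ⟨S, hS, hSc⟩ := hsmall u hu
      obtain ⟨S', hS', hSc'⟩ := hsmall u' hu'
      obtain ⟨R, hR, hRc⟩ := serves_below_union h.normalized hS hS' hu hu' hall
      refine hsolv (hR.solvable ?_)
      have : (R.card : ℝ) ≤ S.card + S'.card := by exact_mod_cast hRc
      linarith

/-- Subtrees that are neither part of a leaf component nor contain one are served by few tours. -/
theorem exists_serves_of_notMem_backbone [Finite V] (h : I.IsLarge Γ) {x : V} (hx : x ∉ I.backbone Γ)
    (hx' : ∀ w, I.IsLeafRoot Γ w → ¬ I.IsAncestor w x) :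
    ∃ S, I.Serves (I.below x) S ∧ (S.card : ℝ) < Γ / 2 := by
  by_contra hcon
  obtain ⟨v, hv, hxv⟩ := h.exists_isLeafCandidate x hcon
  obtain ⟨w, hw, hwv⟩ := hv.exists_isLeafRoot
  rcases hxv.total hwv with h1 | h1
  · exact hx (Or.inr ⟨w, hw, h1⟩)
  · exact hx' w hw h1

theorem exists_isLeafRoot [Finite V] (h : I.IsLarge Γ) : ∃ v, I.IsLeafRoot Γ v := by
  obtain ⟨v, hv, -⟩ := h.exists_isLeafCandidate I.root (by
    rintro ⟨S, hS, hcard⟩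
    exact h.not_solvable_root (hS.solvable (by linarith [h.le_gamma])))
  obtain ⟨w, hw, -⟩ := hv.exists_isLeafRoot
  exact ⟨w, hw⟩

end IsLarge

/-- A leaf root above `v'` is a proper ancestor of it, hence at or above `u`. It would then lie
strictly above the leaf root below `v`, but leaf roots are pairwise incomparable. -/
theorem not_isAncestor_sibling {u v v' : V} (hv : v ∈ I.backbone Γ) (huv : I.IsChild u v)
    (huv' : I.IsChild u v') (hv' : v' ∉ I.backbone Γ) (w : V) (hw : I.IsLeafRoot Γ w) :
    ¬ I.IsAncestor w v' := by
  intro hwv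
  obtain ⟨x, hx, hvx⟩ := exists_isLeafRoot_of_mem_backbone hv huv.ne_root
  have hne : w ≠ v' := by
    rintro rfl
    exact hv' hw.mem_backbone
  have h1 := huv'.isAncestor_of_ne hwv hne
  have h2 := hw.eq_of_isAncestor hx ((h1.trans huv.isAncestor).trans hvx)
  subst h2
  exact huv.not_isAncestor (hvx.trans h1)

/-- Two children in the backbone make a branching vertex. -/
theorem IsNormalized.isBranching [Finite V] (hI : I.IsNormalized) {y u u' : V}
    (hu : I.IsChild y u) (hu' : I.IsChild y u') (hne : u ≠ u') (hub : u ∈ I.backbone Γ)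
    (hub' : u' ∈ I.backbone Γ) : I.IsBranching Γ y := by
  rcases hI.1 y with h0 | h2
  · exact absurd hu (Set.eq_empty_iff_forall_notMem.1 h0 u)
  · refine le_antisymm ?_ ?_
    · rw [← h2]
      exact Set.ncard_le_ncard (fun w hw => hw.1) (Set.toFinite _)
    · rw [← Set.ncard_pair hne]
      refine Set.ncard_le_ncard ?_ (Set.toFinite _)
      rintro w (rfl | rfl)
      · exact ⟨hu, hub⟩
      · exact ⟨hu', hub'⟩

theorem IsBranching.mem_backbone {y : V} (hy : I.IsBranching Γ y) : y ∈ I.backbone Γ := by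
  obtain ⟨u, hu⟩ : {u | I.IsChild y u ∧ u ∈ I.backbone Γ}.Nonempty := by
    refine Set.nonempty_of_ncard_ne_zero ?_
    rw [show _ = 2 from hy]; norm_num
  exact mem_backbone_of_isAncestor hu.2 hu.1.isAncestor

theorem IsBranching.mem_of_isChild [Finite V] (hI : I.IsNormalized) {y u : V}
    (hy : I.IsBranching Γ y) (hu : I.IsChild y u) : u ∈ I.backbone Γ := by
  rcases hI.1 y with h0 | h2
  · exact absurd hu (Set.eq_empty_iff_forall_notMem.1 h0 u)
  · have h3 : {w | I.IsChild y w ∧ w ∈ I.backbone Γ} = {w | I.IsChild y w} :=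
      Set.eq_of_subset_of_ncard_le (fun w hw => hw.1) (by rw [h2, show _ = 2 from hy])
        (Set.toFinite _)
    have h4 : u ∈ {w | I.IsChild y w} := hu
    rw [← h3] at h4
    exact h4.2

/-- Moving the root of a component on the backbone up by one edge costs less than `Γ / 2` tours. -/
theorem IsLarge.exists_serves_between [Finite V] (h : I.IsLarge Γ) {u v e : V}
    (hv : v ∈ I.backbone Γ) (hu : ¬ I.IsBranching Γ u) (huv : I.IsChild u v)
    (hve : I.IsAncestor v e)
    {S : Finset (I.graph.Walk (I.between v e).1 (I.between v e).1)} (hS : I.Serves (I.between v e) S) :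
    ∃ R, I.Serves (I.between u e) R ∧ (R.card : ℝ) < S.card + Γ / 2 := by
  obtain ⟨v', huv', hne, hall⟩ := h.normalized.exists_children huv
  -- Since `u` is not branching, its other child is off the backbone, and the whole subtree there is
  -- served by fewer than `Γ / 2` tours.
  have hv' : v' ∉ I.backbone Γ := fun hv' => hu (h.normalized.isBranching huv huv' hne hv hv')
  obtain ⟨S', hS', hSc'⟩ := h.exists_serves_of_notMem_backbone hv'
    (not_isAncestor_sibling hv huv huv' hv')
  obtain ⟨R, hR, hRc⟩ := Serves.exists_union (D := (I.between u e).2) hS hS' huv huv'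
    (Or.inl ⟨I.isAncestor_refl u, fun heu => huv.not_isAncestor (hve.trans heu)⟩)
    (by
      rintro x (⟨hx1, hx2⟩ | rfl)
      · exact Or.inl ⟨huv.isAncestor.trans hx1, hx2⟩
      · exact Or.inr rfl)
    (by
      intro x hx
      exact Or.inl ⟨huv'.isAncestor.trans hx, fun hex =>
        hne (I.child_unique huv huv' (hve.trans hex) hx)⟩)
    (by
      rintro x hxt (⟨hx1, hx2⟩ | rfl)
      · have hux : u ≠ x := by
          rintro rfl
          exact h.normalized.mem_terminals.1 hxt v huv
        obtain ⟨w, hw, hwx⟩ := IsAncestor.exists_child hx1 hux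
        rcases hall w hw with rfl | rfl
        · exact Or.inl (Or.inl ⟨hwx, hx2⟩)
        · exact Or.inr hwx
      · exact Or.inl (Or.inr rfl))
  refine ⟨R, hR, ?_⟩
  have : (R.card : ℝ) ≤ S.card + S'.card := by exact_mod_cast hRc
  have hSc : (S'.card : ℝ) < Γ / 2 := hSc'
  have : (R.card : ℝ) < S.card + Γ / 2 := by linarith
  exact this

end TreeDVRP

namespace TreeDVRP

variable {V : Type*} {I : TreeDVRP V} {Γ : ℝ}

/-! ### Paths of the backbone -/

theorem IsPathBottom.mem_backbone {b : V} (hb : I.IsPathBottom Γ b) : b ∈ I.backbone Γ :=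
  hb.2.elim IsLeafRoot.mem_backbone IsBranching.mem_backbone

theorem mem_pathTo_self (b : V) : b ∈ I.pathTo Γ b :=
  ⟨I.isAncestor_refl b, fun _ h1 h2 hne => absurd (h2.antisymm h1) hne⟩

theorem mem_pathTo_of_isAncestor {a b x : V} (ha : a ∈ I.pathTo Γ b) (hax : I.IsAncestor a x)
    (hxb : I.IsAncestor x b) : x ∈ I.pathTo Γ b :=
  ⟨hxb, fun y hxy => ha.2 y (hax.trans hxy)⟩

/-- The backbone stops at leaf roots: going on below one would lead to another leaf root. -/
theorem IsLeafRoot.eq_of_isAncestor_backbone {v x : V} (hv : I.IsLeafRoot Γ v)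
    (hx : x ∈ I.backbone Γ) (h : I.IsAncestor v x) : x = v := by
  rcases hx with rfl | ⟨w, hw, hxw⟩
  · exact (I.isAncestor_root_iff.1 h).symm
  · obtain rfl := hv.eq_of_isAncestor hw (h.trans hxw)
    exact hxw.antisymm h

/-- Different paths of the backbone are disjoint. -/
theorem IsPathBottom.unique [Finite V] (hI : I.IsNormalized) {b b' z : V}
    (hb : I.IsPathBottom Γ b) (hb' : I.IsPathBottom Γ b') (hz : z ∈ I.pathTo Γ b)
    (hz' : z ∈ I.pathTo Γ b') : b = b' := by
  have key : ∀ {b b'}, I.IsPathBottom Γ b → I.IsPathBottom Γ b' → z ∈ I.pathTo Γ b →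
      z ∈ I.pathTo Γ b' → I.IsAncestor b b' → b = b' := by
    intro b b' hb hb' hz hz' hanc
    rcases hb.2 with h1 | h1
    · exact (h1.eq_of_isAncestor_backbone hb'.mem_backbone hanc).symm
    · by_contra hne
      exact hz'.2 b hz.1 hanc hne h1
  by_cases h1 : I.IsAncestor b b'
  · exact key hb hb' hz hz' h1
  by_cases h2 : I.IsAncestor b' b
  · exact (key hb' hb hz' hz h2).symm
  -- Incomparable lower ends fork below `z` at a branching vertex, which would be an inner vertex of
  -- the path to `b`.
  obtain ⟨y, u, u', hzy, hu, hu', hne, hub, hub'⟩ := I.exists_branch hz.1 hz'.1 h1 h2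
  refine absurd (hI.isBranching hu hu' hne (mem_backbone_of_isAncestor hb.mem_backbone hub)
    (mem_backbone_of_isAncestor hb'.mem_backbone hub'))
    (hz.2 y hzy (hu.isAncestor.trans hub) ?_)
  rintro rfl
  exact h1 (hu'.isAncestor.trans hub')

/-- Follow the only backbone child downwards until a leaf root or a branching vertex appears. -/
theorem exists_isPathBottom [Finite V] {z : V} (hz : z ∈ I.backbone Γ) (hne : z ≠ I.root) :
    ∃ b, I.IsPathBottom Γ b ∧ z ∈ I.pathTo Γ b := by
  induction z using I.descendant_induction with
  | h z ih =>
    by_cases hzb : I.IsLeafRoot Γ z ∨ I.IsBranching Γ z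
    · exact ⟨z, ⟨hne, hzb⟩, mem_pathTo_self z⟩
    · obtain ⟨v, hv, hzv⟩ := exists_isLeafRoot_of_mem_backbone hz hne
      have hzv' : z ≠ v := by
        rintro rfl
        exact hzb (Or.inl hv)
      obtain ⟨w, hw, hwv⟩ := hzv.exists_child hzv'
      obtain ⟨b, hb, hwb⟩ := ih w hw (Or.inr ⟨v, hv, hwv⟩) hw.ne_root
      refine ⟨b, hb, hw.isAncestor.trans hwb.1, fun y hzy hyb hyb' => ?_⟩
      by_cases hyz : z = y
      · subst hyz
        exact fun hy => hzb (Or.inr hy)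
      · obtain ⟨w', hw', hwy⟩ := hzy.exists_child hyz
        obtain rfl := I.child_unique hw hw' hwb.1 (hwy.trans hyb)
        exact hwb.2 y hwy hyb hyb'

theorem exists_isPathTop (b : V) : ∃ a, I.IsPathTop Γ b a := by
  obtain ⟨a, ha, hmin⟩ := I.exists_minimal_depth (P := fun x => x ∈ I.pathTo Γ b)
    ⟨b, mem_pathTo_self b⟩
  refine ⟨a, ha, fun x hx => ?_⟩
  rcases ha.1.total hx.1 with h1 | h1
  · exact h1
  · rcases h1.depth_le_and with rfl | h2
    · exact I.isAncestor_refl _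
    · exact absurd (hmin x hx) (not_le.2 h2)

theorem IsPathTop.unique {a a' b : V} (h : I.IsPathTop Γ b a) (h' : I.IsPathTop Γ b a') : a = a' :=
  (h.2 a' h'.1).antisymm (h'.2 a h.1)

/-- Otherwise the parent would still belong to the path, above its top. -/
theorem IsPathTop.isBranching {a b p : V} (ha : I.IsPathTop Γ b a) (hp : I.IsChild p a) :
    I.IsBranching Γ p := by
  by_contra hbr
  refine hp.not_isAncestor (ha.2 p ⟨hp.isAncestor.trans ha.1.1, fun y hpy hyb hne => ?_⟩)
  by_cases hyp : p = y
  · exact hyp ▸ hbr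
  · obtain ⟨w, hw, hwy⟩ := hpy.exists_child hyp
    obtain rfl := I.child_unique hp hw ha.1.1 (hwy.trans hyb)
    exact ha.1.2 y hwy hyb hne

/-! ### The loop along a path -/

theorem IsCut.unique {b e v v' : V} (h : I.IsCut Γ b e v) (h' : I.IsCut Γ b e v') : v = v' := by
  by_contra hne
  rcases h.2.1.total h'.2.1 with h1 | h1
  · exact h'.2.2.2 v h.1 h1 hne h.2.2.1
  · exact h.2.2.2 v' h'.1 h1 (Ne.symm hne) h'.2.2.1

theorem LoopValue.mem_pathTo {a b e : V} (h : I.LoopValue Γ b a e) : e ∈ I.pathTo Γ b := by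
  cases h with
  | init => exact mem_pathTo_self b
  | step h hloop hcut => exact hcut.1

/-- The loop runs through its values in a fixed order. -/
theorem LoopValue.total {a b e e' : V} (h : I.LoopValue Γ b a e) (h' : I.LoopValue Γ b a e') :
    e = e' ∨
      (∃ v, ¬ I.Solvable Γ (I.between a e) ∧ I.IsCut Γ b e v ∧ I.IsAncestor e' v) ∨
      ∃ v, ¬ I.Solvable Γ (I.between a e') ∧ I.IsCut Γ b e' v ∧ I.IsAncestor e v := by
  -- One iteration of the loop as a relation. Cuts are unique, so it is a partial function, and of
  -- two values reachable from `b` one is reachable from the other.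
  let r : V → V → Prop := fun x y => ¬ I.Solvable Γ (I.between a x) ∧ I.IsCut Γ b x y
  have hr : Relator.RightUnique r := fun x y z hy hz => hy.2.unique hz.2
  have hreach : ∀ {x}, I.LoopValue Γ b a x → Relation.ReflTransGen r b x := by
    intro x hx
    induction hx with
    | init => exact .refl
    | step h hloop hcut ih => exact ih.tail ⟨hloop, hcut⟩
  have hanc : ∀ {x y}, Relation.ReflTransGen r x y → I.IsAncestor y x := by
    intro x y hxy
    induction hxy with
    | refl => exact I.isAncestor_refl _
    | tail _ hyz ih => exact hyz.2.2.1.trans ih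
  have hcase : ∀ {x y}, Relation.ReflTransGen r x y → x = y ∨
      ∃ v, ¬ I.Solvable Γ (I.between a x) ∧ I.IsCut Γ b x v ∧ I.IsAncestor y v := by
    intro x y hxy
    rcases hxy.cases_head with h1 | ⟨v, h1, h2⟩
    · exact Or.inl h1
    · exact Or.inr ⟨v, h1.1, h1.2, hanc h2⟩
  rcases Relation.ReflTransGen.total_of_right_unique hr (hreach h) (hreach h') with h1 | h1
  · rcases hcase h1 with h2 | h2
    · exact Or.inl h2
    · exact Or.inr (Or.inl h2)
  · rcases hcase h1 with h2 | h2
    · exact Or.inl h2.symm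
    · exact Or.inr (Or.inr h2)

theorem mem_backbone_of_mem_pathTo {b x : V} (hb : I.IsPathBottom Γ b) (hx : x ∈ I.pathTo Γ b) :
    x ∈ I.backbone Γ := mem_backbone_of_isAncestor hb.mem_backbone hx.1

/-- The vertex set is `{e}`, which contains no terminal, so no tour is needed. Each part of a path
grows upwards from this solution. -/
theorem IsLarge.serves_between_self (h : I.IsLarge Γ) {e : V} (he : e ∈ I.backbone Γ)
    (hne : e ≠ I.root) : I.Serves (I.between e e) ∅ := by
  refine ⟨by simp, fun u hu hue => ?_⟩
  rcases hue with h1 | rfl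
  · exact absurd h1.1 h1.2
  · exact absurd hu (h.notMem_terminals he hne)

theorem IsLarge.solvable_between_self (h : I.IsLarge Γ) {e : V} (he : e ∈ I.backbone Γ)
    (hne : e ≠ I.root) : I.Solvable Γ (I.between e e) :=
  (h.serves_between_self he hne).solvable (by simp; linarith [h.le_gamma])

/-- In a run of the loop, the next part can be extended by at least one edge. -/
theorem IsLarge.exists_solvable_above [Finite V] (h : I.IsLarge Γ) {a b e : V}
    (hb : I.IsPathBottom Γ b) (ha : I.IsPathTop Γ b a) (he : e ∈ I.pathTo Γ b)
    (he0 : e ≠ I.root) (hne : a ≠ e) :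
    I.parent e ∈ I.pathTo Γ b ∧ I.Solvable Γ (I.between (I.parent e) e) := by
  have hchild := I.isChild_parent he0
  have hap := hchild.isAncestor_of_ne (ha.2 e he) hne
  have hp := mem_pathTo_of_isAncestor ha.1 hap (hchild.isAncestor.trans he.1)
  refine ⟨hp, ?_⟩
  have heb := mem_backbone_of_mem_pathTo hb he
  obtain ⟨R, hR, hRc⟩ := h.exists_serves_between heb
    (hp.2 _ (I.isAncestor_refl _) (hchild.isAncestor.trans he.1)
      (fun heq => hchild.not_isAncestor (heq ▸ he.1)))
    hchild (I.isAncestor_refl e) (h.serves_between_self heb he0)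
  refine hR.solvable ?_
  rw [Finset.card_empty, Nat.cast_zero, zero_add] at hRc
  linarith [h.le_gamma]

/-- The loop makes progress: one edge above `e` costs fewer than `Γ / 2` tours, so `e` itself is not
the least deep solvable choice. -/
theorem IsLarge.cut_ne [Finite V] (h : I.IsLarge Γ) {a b e v : V} (hb : I.IsPathBottom Γ b)
    (ha : I.IsPathTop Γ b a) (he : e ∈ I.pathTo Γ b) (he0 : e ≠ I.root)
    (hloop : ¬ I.Solvable Γ (I.between a e)) (hcut : I.IsCut Γ b e v) : v ≠ e := by
  rintro rfl
  have hne : a ≠ v := by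
    rintro rfl
    exact hloop hcut.2.2.1
  obtain ⟨h1, h2⟩ := h.exists_solvable_above hb ha he he0 hne
  exact hcut.2.2.2 _ h1 (I.isChild_parent he0).isAncestor (I.isChild_parent he0).ne h2

/-- A cut at the depot makes the depot the top of the path, and solvability of the cut part then
contradicts the loop condition. -/
theorem LoopValue.ne_root {a b e : V}
    (hb : I.IsPathBottom Γ b) (ha : I.IsPathTop Γ b a) (he : I.LoopValue Γ b a e) :
    e ≠ I.root := by
  cases he with
  | init => exact hb.1
  | @step e' _ h1 hloop hcut =>
    rintro rfl
    have : a = I.root := I.isAncestor_root_iff.1 (ha.2 _ hcut.1)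
    exact hloop (this ▸ hcut.2.2.1)

theorem IsLarge.exists_isCut (h : I.IsLarge Γ) {a b e : V}
    (hb : I.IsPathBottom Γ b) (ha : I.IsPathTop Γ b a) (he : I.LoopValue Γ b a e) :
    ∃ v, I.IsCut Γ b e v := by
  have he0 := LoopValue.ne_root hb ha he
  obtain ⟨v, ⟨hv1, hv2, hv3⟩, hmin⟩ := I.exists_minimal_depth
    (P := fun v => v ∈ I.pathTo Γ b ∧ I.IsAncestor v e ∧ I.Solvable Γ (I.between v e))
    ⟨e, he.mem_pathTo, I.isAncestor_refl e,
      h.solvable_between_self (mem_backbone_of_mem_pathTo hb he.mem_pathTo) he0⟩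
  refine ⟨v, hv1, hv2, hv3, fun u hu huv hne hsolv => ?_⟩
  exact absurd (hmin u ⟨hu, huv.trans hv2, hsolv⟩) (not_le.2 (huv.depth_lt hne))

/-- A part cut off in the loop needs at least `Γ / 2` tours. -/
theorem IsLarge.le_card_of_isCut [Finite V] (h : I.IsLarge Γ) {a b e v : V}
    (hb : I.IsPathBottom Γ b) (ha : I.IsPathTop Γ b a)
    (hloop : ¬ I.Solvable Γ (I.between a e)) (hcut : I.IsCut Γ b e v)
    {S : Finset (I.graph.Walk (I.between v e).1 (I.between v e).1)}
    (hS : I.Serves (I.between v e) S) : Γ / 2 ≤ S.card := by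
  have hne : a ≠ v := by
    rintro rfl
    exact hloop hcut.2.2.1
  have hv0 : v ≠ I.root := by
    rintro rfl
    exact hne (I.isAncestor_root_iff.1 (ha.2 _ hcut.1))
  have hchild := I.isChild_parent hv0
  have hap := hchild.isAncestor_of_ne (ha.2 v hcut.1) hne
  have hp := mem_pathTo_of_isAncestor ha.1 hap (hchild.isAncestor.trans hcut.1.1)
  obtain ⟨R, hR, hRc⟩ := h.exists_serves_between (mem_backbone_of_mem_pathTo hb hcut.1)
    (hp.2 _ (I.isAncestor_refl _) (hchild.isAncestor.trans hcut.1.1)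
      (fun heq => hchild.not_isAncestor (heq ▸ hcut.1.1)))
    hchild hcut.2.1 hS
  -- With fewer than `Γ / 2` tours for `v`, the part up to its parent would be solvable with fewer
  -- than `Γ`, although `v` is least deep.
  by_contra hlt
  exact hcut.2.2.2 _ hp hchild.isAncestor hchild.ne (hR.solvable (by linarith))

/-! ### Components along the paths -/

/-- The component with exit vertex `e` that is split off the path with lower end `b` and top
`a`. -/
inductive IsSegment (I : TreeDVRP V) (Γ : ℝ) (b a e : V) : Component V → Prop
  | cut {v : V} (hloop : ¬ I.Solvable Γ (I.between a e)) (hcut : I.IsCut Γ b e v) :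
      IsSegment I Γ b a e (I.between v e)
  | lastDepot (ha : a = I.root) (hloop : I.Solvable Γ (I.between a e)) :
      IsSegment I Γ b a e (I.between a e)
  | last {p : V} (hloop : I.Solvable Γ (I.between a e)) (hp : I.IsChild p a) :
      IsSegment I Γ b a e (p, insert p (I.between a e).2)

theorem IsSegment.unique {a b e : V} {c c' : Component V} (h : I.IsSegment Γ b a e c)
    (h' : I.IsSegment Γ b a e c') : c = c' := by
  cases h with
  | cut hloop hcut =>
    cases h' with
    | cut hloop' hcut' => rw [hcut.unique hcut']
    | lastDepot ha hloop' => exact absurd hloop' hloop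
    | last hloop' hp => exact absurd hloop' hloop
  | lastDepot ha hloop =>
    cases h' with
    | cut hloop' hcut' => exact absurd hloop hloop'
    | lastDepot ha hloop' => rfl
    | last hloop' hp => exact absurd ha hp.ne_root
  | last hloop hp =>
    cases h' with
    | cut hloop' hcut' => exact absurd hloop hloop'
    | lastDepot ha hloop' => exact absurd ha hp.ne_root
    | last hloop' hp' => rw [hp.unique hp']

theorem isComponent_iff {c : Component V} : I.IsComponent Γ c ↔
    (∃ v, I.IsLeafRoot Γ v ∧ c = I.below v) ∨ ∃ b a e, I.IsPathBottom Γ b ∧ I.IsPathTop Γ b a ∧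
      I.LoopValue Γ b a e ∧ I.IsSegment Γ b a e c := by
  constructor
  · intro h
    cases h with
    | leaf h => exact Or.inl ⟨_, h, rfl⟩
    | cut hb ha h hloop hcut => exact Or.inr ⟨_, _, _, hb, ha, h, .cut hloop hcut⟩
    | lastDepot hb ha h hloop => exact Or.inr ⟨_, _, _, hb, ha, h, .lastDepot rfl hloop⟩
    | last hb ha h hloop hp => exact Or.inr ⟨_, _, _, hb, ha, h, .last hloop hp⟩
  · rintro (⟨v, hv, rfl⟩ | ⟨b, a, e, hb, ha, he, hseg⟩)
    · exact .leaf hv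
    · cases hseg with
      | cut hloop hcut => exact .cut hb ha he hloop hcut
      | lastDepot hroot hloop =>
        subst hroot
        exact .lastDepot hb ha he hloop
      | last hloop hp => exact .last hb ha he hloop hp

/-- A component on a path consists of its root and a part `T(a') \ T(e)` for a vertex `a'` of the
path. -/
theorem IsLarge.segment_shape [Finite V] (h : I.IsLarge Γ) {a b e : V} {c : Component V}
    (hb : I.IsPathBottom Γ b) (ha : I.IsPathTop Γ b a) (he : I.LoopValue Γ b a e)
    (hc : I.IsSegment Γ b a e c) :
    ∃ a', a' ∈ I.pathTo Γ b ∧ I.IsAncestor a' e ∧ (c.1 = a' ∨ I.IsChild c.1 a') ∧ c.1 ≠ e ∧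
      c.2 = insert c.1 (I.between a' e).2 := by
  have he0 := LoopValue.ne_root hb ha he
  have hins : ∀ {v}, v ≠ e → I.IsAncestor v e →
      (I.between v e).2 = insert v (I.between v e).2 := fun {v} hne hve =>
    (Set.insert_eq_of_mem (show v ∈ (I.between v e).2 from
      Or.inl ⟨I.isAncestor_refl v, fun hev => hne (hve.antisymm hev)⟩)).symm
  cases hc with
  | @cut v hloop hcut =>
    have hne := h.cut_ne hb ha he.mem_pathTo he0 hloop hcut
    exact ⟨v, hcut.1, hcut.2.1, Or.inl rfl, hne, hins hne hcut.2.1⟩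
  | lastDepot hroot hloop =>
    subst hroot
    exact ⟨I.root, ha.1, I.root_isAncestor e, Or.inl rfl, he0.symm,
      hins he0.symm (I.root_isAncestor e)⟩
  | last hloop hp =>
    have hae := ha.2 e he.mem_pathTo
    refine ⟨a, ha.1, hae, Or.inr hp, fun hpe => ?_, rfl⟩
    simp only at hpe
    exact hp.not_isAncestor (hpe ▸ hae)

/-- The backbone vertices of a part `T(a') \ T(e)` of a path are the ancestors of `e`. -/
theorem isAncestor_of_mem_between [Finite V] (hI : I.IsNormalized) {a' b e x : V}
    (hb : I.IsPathBottom Γ b)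
    (ha' : a' ∈ I.pathTo Γ b) (he : e ∈ I.pathTo Γ b) (hae : I.IsAncestor a' e)
    (hx : x ∈ (I.between a' e).2) (hxT : x ∈ I.backbone Γ) : I.IsAncestor x e := by
  rcases hx with ⟨hax, hex⟩ | rfl
  · by_contra hxe
    obtain ⟨y, u, u', hay, hu, hu', hne, hux, hue⟩ := I.exists_branch hax hae hxe hex
    refine absurd (hI.isBranching hu hu' hne (mem_backbone_of_isAncestor hxT hux)
      (mem_backbone_of_isAncestor (mem_backbone_of_mem_pathTo hb he) hue))
      (ha'.2 y hay ((hu'.isAncestor.trans hue).trans he.1) ?_)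
    rintro rfl
    exact hu'.not_isAncestor (hue.trans he.1)
  · exact I.isAncestor_refl x

/-! ### Feet on the backbone and disjointness of the components -/

/-- The backbone vertex that determines the component of `x`: it is `x` itself or, off the backbone,
the next vertex of the backbone below the place where the way from the depot to `x` leaves it. -/
def IsFoot (I : TreeDVRP V) (Γ : ℝ) (x z : V) : Prop :=
  z ∈ I.backbone Γ ∧ (z = x ∨ (x ∉ I.backbone Γ ∧ ∃ y, I.IsChild y z ∧ I.IsAncestor y x ∧
    ¬ I.IsBranching Γ y ∧ ∀ w ∈ I.backbone Γ, I.IsAncestor w x → I.IsAncestor w y))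

/-- Off the backbone, `y` is the deepest backbone ancestor of `x` and so is determined by `x`. Not
being branching, it has only one child in the backbone. -/
theorem IsFoot.unique [Finite V] (hI : I.IsNormalized) {x z z' : V} (h : I.IsFoot Γ x z)
    (h' : I.IsFoot Γ x z') : z = z' := by
  obtain ⟨hz, rfl | ⟨hx, y, hyz, hyx, hybr, hmax⟩⟩ := h
  · obtain ⟨hz', rfl | ⟨hx', -⟩⟩ := h'
    · rfl
    · exact absurd hz hx'
  · obtain ⟨hz', rfl | ⟨hx', y', hyz', hyx', -, hmax'⟩⟩ := h'
    · exact absurd hz' hx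
    · have hyy : y = y' :=
        (hmax' y (mem_backbone_of_isAncestor hz hyz.isAncestor) hyx).antisymm
          (hmax y' (mem_backbone_of_isAncestor hz' hyz'.isAncestor) hyx')
      subst hyy
      by_contra hne
      exact hybr (hI.isBranching hyz hyz' hne hz hz')

/-- Places every non-root vertex of a segment on the stretch of the backbone strictly below the root
of the segment and down to its exit. As the foot depends only on `x`, overlaps of segments reduce to
overlaps of such stretches. -/
theorem IsLarge.exists_isFoot [Finite V] (h : I.IsLarge Γ) {a b e x : V} {c : Component V}
    (hb : I.IsPathBottom Γ b) (ha : I.IsPathTop Γ b a) (he : I.LoopValue Γ b a e)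
    (hc : I.IsSegment Γ b a e c) (hx : x ∈ c.2) (hxc : x ≠ c.1) :
    ∃ z, I.IsFoot Γ x z ∧ z ∈ I.pathTo Γ b ∧ I.IsAncestor c.1 z ∧ z ≠ c.1 ∧ I.IsAncestor z e := by
  obtain ⟨a', ha', hae, hca, hce, hcset⟩ := h.segment_shape hb ha he hc
  have heb := mem_backbone_of_mem_pathTo hb he.mem_pathTo
  have hca' : I.IsAncestor c.1 a' := by
    rcases hca with h1 | h1
    · rw [h1]; exact I.isAncestor_refl _
    · exact h1.isAncestor
  have hxb : x ∈ (I.between a' e).2 := by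
    rw [hcset] at hx
    exact hx.resolve_left hxc
  by_cases hxe : I.IsAncestor x e
  · have hax : I.IsAncestor a' x := by
      rcases hxb with h1 | rfl
      · exact h1.1
      · exact hae
    exact ⟨x, ⟨mem_backbone_of_isAncestor heb hxe, Or.inl rfl⟩,
      mem_pathTo_of_isAncestor ha' hax (hxe.trans he.mem_pathTo.1), hca'.trans hax, hxc, hxe⟩
  · have hxT : x ∉ I.backbone Γ := fun hxT =>
      hxe (isAncestor_of_mem_between h.normalized hb ha' he.mem_pathTo hae hxb hxT)
    have hxb' : I.IsAncestor a' x ∧ ¬ I.IsAncestor e x := by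
      rcases hxb with h1 | rfl
      · exact h1
      · exact absurd (I.isAncestor_refl _) hxe
    obtain ⟨y, u, u', hay, hu, hu', hne, hux, hue⟩ := I.exists_branch hxb'.1 hae hxe hxb'.2
    have hu'T := mem_backbone_of_isAncestor heb hue
    have hub := hue.trans he.mem_pathTo.1
    have hybr : ¬ I.IsBranching Γ y := ha'.2 y hay (hu'.isAncestor.trans hub) (by
      rintro rfl
      exact hu'.not_isAncestor hub)
    have huT : u ∉ I.backbone Γ := fun huT =>
      hybr (h.normalized.isBranching hu hu' hne huT hu'T)
    refine ⟨u', ⟨hu'T, Or.inr ⟨hxT, y, hu', hu.isAncestor.trans hux, hybr, fun w hw hwx => ?_⟩⟩,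
      mem_pathTo_of_isAncestor ha' (hay.trans hu'.isAncestor) hub,
      (hca'.trans hay).trans hu'.isAncestor, ?_, hue⟩
    · rcases hwx.total hux with h1 | h1
      · refine hu.isAncestor_of_ne h1 ?_
        rintro rfl
        exact huT hw
      · exact absurd (mem_backbone_of_isAncestor hw h1) huT
    · rintro rfl
      exact hu'.not_isAncestor (hca'.trans hay)

/-- Roots of components and exit vertices. -/
def IsJoint (I : TreeDVRP V) (Γ : ℝ) (x : V) : Prop :=
  I.IsLeafRoot Γ x ∨ I.IsBranching Γ x ∨ x = I.root ∨
    ∃ b a, I.IsPathBottom Γ b ∧ I.IsPathTop Γ b a ∧ I.LoopValue Γ b a x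

/-- The vertex `e` is the exit vertex of the component `c`. -/
def HasExit (I : TreeDVRP V) (Γ : ℝ) (c : Component V) (e : V) : Prop :=
  (I.IsLeafRoot Γ e ∧ c = I.below e) ∨ ∃ b a, I.IsPathBottom Γ b ∧ I.IsPathTop Γ b a ∧
    I.LoopValue Γ b a e ∧ I.IsSegment Γ b a e c

theorem IsComponent.exists_hasExit {c : Component V} (h : I.IsComponent Γ c) :
    ∃ e, I.HasExit Γ c e := by
  rcases isComponent_iff.1 h with ⟨v, hv, rfl⟩ | ⟨b, a, e, hseg⟩
  · exact ⟨v, Or.inl ⟨hv, rfl⟩⟩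
  · exact ⟨e, Or.inr ⟨b, a, hseg⟩⟩

theorem IsJoint.mem_backbone {x : V} (h : I.IsJoint Γ x) : x ∈ I.backbone Γ := by
  rcases h with h | h | rfl | ⟨b, a, hb, -, h⟩
  · exact h.mem_backbone
  · exact h.mem_backbone
  · exact Or.inl rfl
  · exact mem_backbone_of_mem_pathTo hb h.mem_pathTo

theorem HasExit.isJoint_exit {c : Component V} {e : V} (h : I.HasExit Γ c e) : I.IsJoint Γ e := by
  rcases h with ⟨h, -⟩ | ⟨b, a, hb, ha, he, -⟩
  · exact Or.inl h
  · exact Or.inr (Or.inr (Or.inr ⟨b, a, hb, ha, he⟩))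

theorem HasExit.isJoint_root {c : Component V} {e : V} (h : I.HasExit Γ c e) :
    I.IsJoint Γ c.1 := by
  rcases h with ⟨h, rfl⟩ | ⟨b, a, hb, ha, he, hseg⟩
  · exact Or.inl h
  · cases hseg with
    | cut hloop hcut => exact Or.inr (Or.inr (Or.inr ⟨b, a, hb, ha, he.step hloop hcut⟩))
    | lastDepot hroot hloop => exact Or.inr (Or.inr (Or.inl hroot))
    | last hloop hp => exact Or.inr (Or.inl (ha.isBranching hp))

theorem IsLarge.isPiece [Finite V] (h : I.IsLarge Γ) {c : Component V} {e : V}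
    (hc : I.HasExit Γ c e) : I.IsPiece c e := by
  rcases hc with ⟨hv, rfl⟩ | ⟨b, a, hb, ha, he, hseg⟩
  · exact
      { root_mem := I.isAncestor_refl e
        exit_mem := I.isAncestor_refl e
        isAncestor := fun x hx => hx
        parent_mem := fun x hx hne => by
          have hx0 : x ≠ I.root := by
            rintro rfl
            exact hne (I.isAncestor_root_iff.1 hx).symm
          exact (I.isChild_parent hx0).isAncestor_of_ne hx (Ne.symm hne)
        mem_of_isAncestor := fun x hx _ y hxy _ => IsAncestor.trans hx hxy
        eq_exit := fun hne => absurd rfl hne }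
  · obtain ⟨a', ha', hae, hca, hce, hcset⟩ := h.segment_shape hb ha he hseg
    have hca' : I.IsAncestor c.1 a' := by
      rcases hca with h1 | h1
      · rw [h1]; exact I.isAncestor_refl _
      · exact h1.isAncestor
    have hmem : ∀ x, x ∈ c.2 ↔ x = c.1 ∨ x ∈ (I.between a' e).2 := fun x => by
      rw [hcset]; exact Set.mem_insert_iff
    have hbelow : ∀ x ∈ (I.between a' e).2, I.IsAncestor a' x := by
      rintro x (h1 | rfl)
      · exact h1.1
      · exact hae
    have hanc : ∀ x ∈ c.2, I.IsAncestor c.1 x := fun x hx => by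
      rcases (hmem x).1 hx with rfl | h1
      · exact I.isAncestor_refl _
      · exact hca'.trans (hbelow x h1)
    refine ⟨(hmem _).2 (Or.inl rfl), (hmem _).2 (Or.inr (Or.inr rfl)), hanc, ?_, ?_, ?_⟩
    · intro x hx hne
      have hx0 : x ≠ I.root := by
        rintro rfl
        exact hne (I.isAncestor_root_iff.1 (hanc _ hx)).symm
      have hxb := ((hmem x).1 hx).resolve_left hne
      have hchild := I.isChild_parent hx0
      by_cases hxa : a' = x
      · subst hxa
        rcases hca with h1 | h1
        · exact absurd h1.symm hne
        · exact (hmem _).2 (Or.inl (hchild.unique h1))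
      · refine (hmem _).2 (Or.inr (Or.inl ⟨hchild.isAncestor_of_ne (hbelow x hxb) hxa, ?_⟩))
        rcases hxb with h1 | rfl
        · exact fun h2 => h1.2 (h2.trans hchild.isAncestor)
        · exact hchild.not_isAncestor
    · intro x hx hne y hxy hey
      exact (hmem _).2 (Or.inr (Or.inl
        ⟨(hbelow x (((hmem x).1 hx).resolve_left hne)).trans hxy, hey (Ne.symm hce)⟩))
    · intro _ x hx hex
      rcases (hmem x).1 hx with rfl | h1 | rfl
      · exact (hanc _ ((hmem e).2 (Or.inr (Or.inr rfl)))).antisymm hex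
      · exact absurd hex h1.2
      · rfl

/-- Of two different loop values, the later one lies at or above the root of the component cut off
at the earlier one. -/
theorem IsSegment.eq_exit_or_isAncestor {a b e e' : V} {c c' : Component V}
    (he : I.LoopValue Γ b a e) (he' : I.LoopValue Γ b a e') (hc : I.IsSegment Γ b a e c)
    (hc' : I.IsSegment Γ b a e' c') :
    e = e' ∨ I.IsAncestor e' c.1 ∨ I.IsAncestor e c'.1 := by
  have key : ∀ {e v w c}, I.IsSegment Γ b a e c → ¬ I.Solvable Γ (I.between a e) →
      I.IsCut Γ b e v → I.IsAncestor w v → I.IsAncestor w c.1 := by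
    intro e v w c hc hloop hcut hw
    rw [hc.unique (.cut hloop hcut)]
    exact hw
  rcases he.total he' with h1 | ⟨v, h1, h2, h3⟩ | ⟨v, h1, h2, h3⟩
  · exact Or.inl h1
  · exact Or.inr (Or.inl (key hc h1 h2 h3))
  · exact Or.inr (Or.inr (key hc' h1 h2 h3))

/-- Look at the foot `z` of `x`. If `x` is on the backbone, it cannot be below `v`. If it is not,
then `v` would be at or above the parent of `z`, so the backbone would continue below a leaf root.
-/
theorem IsLarge.not_leaf_and_segment [Finite V] (h : I.IsLarge Γ) {v a b e x : V} {c : Component V}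
    (hv : I.IsLeafRoot Γ v) (hb : I.IsPathBottom Γ b) (ha : I.IsPathTop Γ b a)
    (he : I.LoopValue Γ b a e) (hc : I.IsSegment Γ b a e c) (hx : x ∈ c.2) (hxc : x ≠ c.1)
    (hxv : x ≠ v) : ¬ I.IsAncestor v x := by
  intro hvx
  obtain ⟨z, ⟨hz, rfl | ⟨hxT, y, hyz, hyx, -, hmax⟩⟩, -⟩ := h.exists_isFoot hb ha he hc hx hxc
  · exact hxv (hv.eq_of_isAncestor_backbone hz hvx)
  · have h1 := hmax v hv.mem_backbone hvx
    have h2 := hv.eq_of_isAncestor_backbone hz (h1.trans hyz.isAncestor)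
    exact hyz.not_isAncestor (h2 ▸ h1)

/-- For two segments, the common foot of `x` forces the same path. It lies strictly below both roots
and at or above both exits, whereas different segments of one path have disjoint stretches. -/
theorem IsLarge.eq_of_mem [Finite V] (h : I.IsLarge Γ) {c c' : Component V} {e e' x : V}
    (hc : I.HasExit Γ c e) (hc' : I.HasExit Γ c' e') (hx : x ∈ c.2) (hx' : x ∈ c'.2)
    (hne : x ≠ c.1) (hne' : x ≠ c'.1) : c = c' := by
  rcases hc with ⟨hv, rfl⟩ | ⟨b, a, hb, ha, he, hseg⟩
  · rcases hc' with ⟨hv', rfl⟩ | ⟨b', a', hb', ha', he', hseg'⟩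
    · rw [hv.eq_of_isAncestor_of_isAncestor hv' hx hx']
    · exact absurd hx (h.not_leaf_and_segment hv hb' ha' he' hseg' hx' hne' hne)
  · rcases hc' with ⟨hv', rfl⟩ | ⟨b', a', hb', ha', he', hseg'⟩
    · exact absurd hx' (h.not_leaf_and_segment hv' hb ha he hseg hx hne hne')
    · obtain ⟨z, hz, hzb, hcz, hzc, hze⟩ := h.exists_isFoot hb ha he hseg hx hne
      obtain ⟨z', hz', hzb', hcz', hzc', hze'⟩ := h.exists_isFoot hb' ha' he' hseg' hx' hne'
      obtain rfl := hz.unique h.normalized hz'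
      obtain rfl := hb.unique h.normalized hb' hzb hzb'
      obtain rfl := ha.unique ha'
      rcases IsSegment.eq_exit_or_isAncestor he he' hseg hseg' with rfl | h1 | h1
      · exact hseg.unique hseg'
      · exact absurd ((hze'.trans h1).antisymm hcz) hzc
      · exact absurd ((hze.trans h1).antisymm hcz') hzc'

/-- A joint is on the backbone and hence is its own foot. In a segment it therefore lies strictly
below the root and at or above `e`, and there each of the four kinds of joints is either excluded or
equal to `e`. -/
theorem IsLarge.eq_root_or_exit [Finite V] (h : I.IsLarge Γ) {c : Component V} {e x : V}
    (hc : I.HasExit Γ c e) (hx : x ∈ c.2) (hj : I.IsJoint Γ x) : x = c.1 ∨ x = e := by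
  rcases hc with ⟨hv, rfl⟩ | ⟨b, a, hb, ha, he, hseg⟩
  · exact Or.inl (hv.eq_of_isAncestor_backbone hj.mem_backbone hx)
  · by_cases hne : x = c.1
    · exact Or.inl hne
    right
    obtain ⟨z, hz, hzb, hcz, hzc, hze⟩ := h.exists_isFoot hb ha he hseg hx hne
    obtain rfl : z = x := hz.unique h.normalized ⟨hj.mem_backbone, Or.inl rfl⟩
    rcases hj with hv | hbr | rfl | ⟨b', a', hb', ha', hz'⟩
    · exact (hv.eq_of_isAncestor_backbone (mem_backbone_of_mem_pathTo hb he.mem_pathTo) hze).symm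
    · by_cases hzb' : z = b
      · exact hze.antisymm (hzb' ▸ he.mem_pathTo.1)
      · exact absurd hbr (hzb.2 z (I.isAncestor_refl z) hzb.1 hzb')
    · exact absurd (I.isAncestor_root_iff.1 hcz).symm hzc
    · obtain rfl := hb.unique h.normalized hb' hzb hz'.mem_pathTo
      obtain rfl := ha.unique ha'
      rcases he.total hz' with h1 | ⟨v, h1, h2, h3⟩ | ⟨v, h1, h2, h3⟩
      · exact h1.symm
      · rw [hseg.unique (.cut h1 h2)] at hcz hzc
        exact absurd (h3.antisymm hcz) hzc
      · exact hze.antisymm (h3.trans h2.2.1)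

/-- The components form a decomposition. -/
theorem IsLarge.exists_isDecomposition [Finite V] (h : I.IsLarge Γ) :
    ∃ e, I.IsDecomposition (I.components Γ) e := by
  classical
  have hmem : ∀ c, c ∈ I.components Γ ↔ I.IsComponent Γ c := fun c => by simp [components]
  have hex : ∀ c : Component V, ∃ e, I.IsComponent Γ c → I.HasExit Γ c e := fun c => by
    by_cases hc : I.IsComponent Γ c
    · obtain ⟨e, he⟩ := hc.exists_hasExit
      exact ⟨e, fun _ => he⟩
    · exact ⟨c.1, fun hc' => absurd hc' hc⟩
  choose e he using hex
  have he : ∀ c ∈ I.components Γ, I.HasExit Γ c (e c) := fun c hc => he c ((hmem c).1 hc)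
  refine ⟨e, fun c hc => h.isPiece (he c hc), fun c hc c' hc' x hx hx' hne hne' =>
    h.eq_of_mem (he c hc) (he c' hc') hx hx' hne hne', fun c hc c' hc' x hx hxj =>
    h.eq_root_or_exit (he c hc) hx ?_⟩
  rcases hxj with rfl | rfl
  · exact (he c' hc').isJoint_root
  · exact (he c' hc').isJoint_exit

/-! ### Coverage of the terminals and solvability of the components -/

/-- Every backbone edge whose upper end is not branching belongs to a component on its path. -/
theorem IsLarge.exists_segment [Finite V] (h : I.IsLarge Γ) {a b y z : V}
    (hb : I.IsPathBottom Γ b) (ha : I.IsPathTop Γ b a) (hz : z ∈ I.pathTo Γ b)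
    (hyz : I.IsChild y z) (hy : ¬ I.IsBranching Γ y) :
    ∃ e c, I.LoopValue Γ b a e ∧ I.IsSegment Γ b a e c ∧ I.IsAncestor z e ∧
      ∀ x, I.IsAncestor y x → ¬ I.IsAncestor e x → x ∈ c.2 := by
  have hyb : y ∈ I.pathTo Γ b := by
    refine ⟨hyz.isAncestor.trans hz.1, fun w hyw hwb hne => ?_⟩
    by_cases hwy : y = w
    · exact hwy ▸ hy
    · obtain ⟨z', hz', hzw⟩ := hyw.exists_child hwy
      obtain rfl := I.child_unique hyz hz' hz.1 (hzw.trans hwb)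
      exact hz.2 w hzw hwb hne
  -- The highest loop value at or below `z`. The next cut, if there is one, lies strictly above `z`,
  -- that is, at or above `y`.
  obtain ⟨e, ⟨he, hze⟩, hmin⟩ := I.exists_minimal_depth
    (P := fun e => I.LoopValue Γ b a e ∧ I.IsAncestor z e) ⟨b, .init, hz.1⟩
  by_cases hloop : I.Solvable Γ (I.between a e)
  · by_cases hroot : a = I.root
    · exact ⟨e, _, he, .lastDepot hroot hloop, hze, fun x hx hex =>
        Or.inl ⟨(ha.2 y hyb).trans hx, hex⟩⟩
    · exact ⟨e, _, he, .last hloop (I.isChild_parent hroot), hze, fun x hx hex =>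
        Or.inr (Or.inl ⟨(ha.2 y hyb).trans hx, hex⟩)⟩
  · obtain ⟨v, hv⟩ := h.exists_isCut hb ha he
    have hne := h.cut_ne hb ha he.mem_pathTo (LoopValue.ne_root hb ha he) hloop hv
    have hzv : ¬ I.IsAncestor z v := fun hzv =>
      absurd (hmin v ⟨he.step hloop hv, hzv⟩) (not_le.2 (hv.2.1.depth_lt hne))
    have hvy : I.IsAncestor v y := by
      refine hyz.isAncestor_of_ne ((hv.2.1.total hze).resolve_right hzv) ?_
      rintro rfl
      exact hzv (I.isAncestor_refl _)
    exact ⟨e, _, he, .cut hloop hv, hze, fun x hx hex => Or.inl ⟨hvy.trans hx, hex⟩⟩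

/-- Every terminal belongs to a component. -/
theorem IsLarge.exists_isComponent [Finite V] (h : I.IsLarge Γ) {u : V} (hu : u ∈ I.terminals) :
    ∃ c, I.IsComponent Γ c ∧ u ∈ c.2 := by
  by_cases hleaf : ∃ v, I.IsLeafRoot Γ v ∧ I.IsAncestor v u
  · obtain ⟨v, hv, hvu⟩ := hleaf
    exact ⟨_, .leaf hv, hvu⟩
  push Not at hleaf
  have huT : u ∉ I.backbone Γ := fun huT => by
    by_cases hu0 : u = I.root
    · subst hu0
      obtain ⟨S, hS, hcard⟩ := exists_serves_terminal h.normalized hu (h.two_mul_dist_le _)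
      exact h.not_solvable_root (hS.solvable (by rw [hcard]; norm_num; linarith [h.le_gamma]))
    · exact h.notMem_terminals huT hu0 hu
  -- The vertex `y` where the way to `u` leaves the backbone. It is not branching, so the component
  -- containing the backbone edge below `y` also contains `u`.
  obtain ⟨y, ⟨hyT, hyu⟩, hmax⟩ : ∃ y, (y ∈ I.backbone Γ ∧ I.IsAncestor y u) ∧
      ∀ w, w ∈ I.backbone Γ → I.IsAncestor w u → I.IsAncestor w y := by
    obtain ⟨y, hy, hmax⟩ := Set.exists_max_image {y | y ∈ I.backbone Γ ∧ I.IsAncestor y u} I.depth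
      (Set.toFinite _) ⟨I.root, Or.inl rfl, I.root_isAncestor u⟩
    refine ⟨y, hy, fun w hw hwu => ?_⟩
    rcases hwu.total hy.2 with h1 | h1
    · exact h1
    · rcases h1.depth_le_and with rfl | h2
      · exact I.isAncestor_refl _
      · exact absurd (hmax w ⟨hw, hwu⟩) (not_le.2 h2)
  have hne : y ≠ u := by
    rintro rfl
    exact huT hyT
  obtain ⟨w, hw, hwu⟩ := hyu.exists_child hne
  have hybr : ¬ I.IsBranching Γ y := fun hybr =>
    hw.not_isAncestor (hmax w (hybr.mem_of_isChild h.normalized hw) hwu)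
  obtain ⟨v, hv, hyv⟩ : ∃ v, I.IsLeafRoot Γ v ∧ I.IsAncestor y v := by
    rcases hyT with rfl | hyT
    · obtain ⟨v, hv⟩ := h.exists_isLeafRoot
      exact ⟨v, hv, I.root_isAncestor v⟩
    · exact hyT
  have hyv' : y ≠ v := by
    rintro rfl
    exact hleaf y hv hyu
  obtain ⟨z, hz, hzv⟩ := hyv.exists_child hyv'
  have hzT : z ∈ I.backbone Γ := Or.inr ⟨v, hv, hzv⟩
  obtain ⟨b, hb, hzb⟩ := exists_isPathBottom hzT hz.ne_root
  obtain ⟨a, ha⟩ := exists_isPathTop (I := I) (Γ := Γ) b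
  obtain ⟨e, c, he, hc, hze, hmem⟩ := h.exists_segment hb ha hzb hz hybr
  refine ⟨c, isComponent_iff.2 (Or.inr ⟨b, a, e, hb, ha, he, hc⟩), hmem u hyu fun heu => ?_⟩
  exact hz.not_isAncestor (hmax z hzT (hze.trans heu))

/-- Only the last component of a path needs an argument: the longer limit at the parent pays exactly
for traversing the added edge twice, and the parent is not a terminal. -/
theorem IsComponent.solvable (hI : I.IsNormalized) {c : Component V} (h : I.IsComponent Γ c) :
    I.Solvable Γ c := by
  cases h with
  | leaf h => exact h.1.1
  | cut hb ha h hloop hcut => exact hcut.2.2.1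
  | lastDepot hb ha h hloop => exact hloop
  | @last b a e p hb ha h hloop hp =>
    obtain ⟨S, hS, hSc, -⟩ := hloop.exists_serves
    obtain ⟨R, hR, hR1, hR2⟩ := Serves.exists_lift hS hp
    refine Serves.solvable (S := R) ⟨fun t ht => hR1 t ht, fun u hu huc => ?_⟩ ?_
    · rcases huc with rfl | huc
      · exact absurd hp (hI.mem_terminals.1 hu _)
      · exact hR2 u hu huc
    · exact le_trans (by exact_mod_cast hR) hSc

end TreeDVRP

namespace TreeDVRP

variable {V : Type*} {I : TreeDVRP V} {Γ : ℝ}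

/-! ### The number of components -/

open Classical in
/-- The backbone has fewer branching vertices than leaves. -/
theorem IsLarge.card_isBranching_le [Fintype V] (h : I.IsLarge Γ) :
    (Finset.univ.filter fun x => I.IsBranching Γ x).card ≤
      (Finset.univ.filter fun x => I.IsLeafRoot Γ x).card := by
  set T : Finset V := Finset.univ.filter fun x => x ∈ I.backbone Γ with hT
  have hmem : ∀ x, x ∈ T ↔ x ∈ I.backbone Γ := fun x => by simp [hT]
  have hroot : I.root ∈ T := (hmem _).2 (Or.inl rfl)
  have hfiber : ∀ x, (((T.erase I.root).filter fun y => I.parent y = x : Finset V) : Set V) =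
      {y | I.IsChild x y ∧ y ∈ I.backbone Γ} := fun x => by
    ext y
    simp only [Finset.coe_filter, Finset.mem_erase, hmem, Set.mem_ofPred_eq, I.isChild_iff]
    constructor
    · rintro ⟨⟨h1, h2⟩, rfl⟩
      exact ⟨⟨h1, rfl⟩, h2⟩
    · rintro ⟨⟨h1, rfl⟩, h2⟩
      exact ⟨⟨h1, h2⟩, rfl⟩
  have hcard := Finset.card_eq_sum_card_fiberwise (s := T.erase I.root) (t := T) (f := I.parent)
    (fun y hy => by
      have hy' := Finset.mem_erase.1 hy
      exact (hmem _).2 (mem_backbone_of_isAncestor ((hmem y).1 hy'.2)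
        (I.parent_isAncestor hy'.1)))
  -- Summing over the backbone counts every vertex except the depot once as a child, so the number
  -- of branching vertices plus 1 is at most the number of leaf roots.
  have hpoint : ∀ x ∈ T, 1 + (if I.IsBranching Γ x then 1 else 0) ≤
      ((T.erase I.root).filter fun y => I.parent y = x).card +
        (if I.IsLeafRoot Γ x then 1 else 0) := by
    intro x hx
    by_cases hbr : I.IsBranching Γ x
    · have : ((T.erase I.root).filter fun y => I.parent y = x).card = 2 := by
        rw [← Set.ncard_coe_finset, hfiber]
        exact hbr
      rw [this, if_pos hbr]
      omega
    · rw [if_neg hbr]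
      by_cases hlf : I.IsLeafRoot Γ x
      · rw [if_pos hlf]; omega
      · rw [if_neg hlf]
        obtain ⟨v, hv, hxv⟩ : ∃ v, I.IsLeafRoot Γ v ∧ I.IsAncestor x v := by
          rcases (hmem x).1 hx with rfl | hx
          · obtain ⟨v, hv⟩ := h.exists_isLeafRoot
            exact ⟨v, hv, I.root_isAncestor v⟩
          · exact hx
        obtain ⟨w, hw, hwv⟩ := hxv.exists_child (by rintro rfl; exact hlf hv)
        have : w ∈ (T.erase I.root).filter fun y => I.parent y = x := by
          rw [← Finset.mem_coe, hfiber]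
          exact ⟨hw, Or.inr ⟨v, hv, hwv⟩⟩
        have := Finset.card_pos.2 ⟨w, this⟩
        omega
  have hsum := Finset.sum_le_sum hpoint
  rw [Finset.sum_add_distrib, Finset.sum_add_distrib, ← hcard, Finset.card_erase_of_mem hroot,
    Finset.sum_const, ← Finset.card_filter, ← Finset.card_filter] at hsum
  have h1 : (T.filter fun x => I.IsBranching Γ x) =
      Finset.univ.filter fun x => I.IsBranching Γ x := by
    ext x
    simp only [Finset.mem_filter, hmem, Finset.mem_univ, true_and, and_iff_right_iff_imp]
    exact IsBranching.mem_backbone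
  have h2 : (T.filter fun x => I.IsLeafRoot Γ x) =
      Finset.univ.filter fun x => I.IsLeafRoot Γ x := by
    ext x
    simp only [Finset.mem_filter, hmem, Finset.mem_univ, true_and, and_iff_right_iff_imp]
    exact IsLeafRoot.mem_backbone
  rw [h1, h2, smul_eq_mul] at hsum
  omega

theorem mem_components [Finite V] {c : Component V} : c ∈ I.components Γ ↔ I.IsComponent Γ c := by
  simp [components]

open Classical in
/-- A third of the components need at least `Γ / 2` tours. -/
theorem IsLarge.card_components_le [Finite V] (h : I.IsLarge Γ) :
    (I.components Γ).card ≤ 3 * ((I.components Γ).filter fun c =>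
      ∀ S, I.Serves c S → Γ / 2 ≤ (S.card : ℝ)).card := by
  cases nonempty_fintype V
  set F := (I.components Γ).filter fun c => ∀ S, I.Serves c S → Γ / 2 ≤ (S.card : ℝ) with hF
  set Z := (I.components Γ).filter fun c => ¬ ∀ S, I.Serves c S → Γ / 2 ≤ (S.card : ℝ) with hZ
  have h1 : F.card + Z.card = (I.components Γ).card := Finset.card_filter_add_card_filter_not _
  have h2 : (Finset.univ.filter fun x => I.IsLeafRoot Γ x).card ≤ F.card := by
    refine Finset.card_le_card_of_injOn I.below (fun v hv => ?_) fun v _ w _ hvw => ?_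
    · have hv : I.IsLeafRoot Γ v := by simpa using hv
      exact Finset.mem_filter.2 ⟨mem_components.2 (.leaf hv), fun S hS =>
        h.le_card_of_leafRoot hv hS⟩
    · exact congrArg Prod.fst hvw
  -- A component that is not known to be expensive is the last one of its path, and every path has
  -- only one last component.
  have h3 : Z.card ≤ (Finset.univ.filter fun b => I.IsPathBottom Γ b).card := by
    refine Finset.card_le_card_of_forall_subsingleton (fun c b => ∃ a e, I.IsPathTop Γ b a ∧
      I.LoopValue Γ b a e ∧ I.Solvable Γ (I.between a e) ∧ I.IsSegment Γ b a e c) ?_ ?_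
    · intro c hc
      obtain ⟨hc, hsmall⟩ := Finset.mem_filter.1 hc
      rcases isComponent_iff.1 (mem_components.1 hc) with ⟨v, hv, rfl⟩ | ⟨b, a, e, hb, ha, he, hseg⟩
      · exact absurd (fun S hS => h.le_card_of_leafRoot hv hS) hsmall
      · refine ⟨b, by simpa using hb, a, e, ha, he, ?_, hseg⟩
        cases hseg with
        | cut hloop hcut => exact absurd (fun S hS => h.le_card_of_isCut hb ha hloop hcut hS) hsmall
        | lastDepot _ hloop => exact hloop
        | last hloop _ => exact hloop
    · rintro b - c ⟨-, a, e, ha, he, hloop, hseg⟩ c' ⟨-, a', e', ha', he', hloop', hseg'⟩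
      obtain rfl := ha.unique ha'
      rcases he.total he' with rfl | ⟨v, h4, -⟩ | ⟨v, h4, -⟩
      · exact hseg.unique hseg'
      · exact absurd hloop h4
      · exact absurd hloop' h4
  -- Paths end in leaf roots or branching vertices, so there are at most twice as many as leaf
  -- roots, and `Z.card ≤ 2 * F.card`.
  have h4 : (Finset.univ.filter fun b => I.IsPathBottom Γ b) ⊆
      (Finset.univ.filter fun x => I.IsLeafRoot Γ x) ∪
        Finset.univ.filter fun x => I.IsBranching Γ x := by
    intro b hb
    simpa using (Finset.mem_filter.1 hb).2.2
  have h5 := (Finset.card_le_card h4).trans (Finset.card_union_le _ _)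
  have h6 := h.card_isBranching_le
  omega

/-! ### The analysis of the algorithm -/

/-- Solutions for components that contain all terminals form a solution for the instance. -/
theorem exists_isFeasible_of_components (Cs : Finset (Component V)) (n : Component V → ℕ)
    (hn : ∀ c ∈ Cs, ∃ S, I.Serves c S ∧ S.card ≤ n c)
    (hcov : ∀ u ∈ I.terminals, ∃ c ∈ Cs, u ∈ c.2) :
    ∃ S, I.IsFeasible I.root Set.univ I.limit S ∧ S.card ≤ ∑ c ∈ Cs, n c := by
  classical
  have key : ∀ c, ∃ R : Finset (I.graph.Walk I.root I.root), c ∈ Cs → R.card ≤ n c ∧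
      (∀ t ∈ R, (I.walkLength t : ℤ) ≤ I.limit) ∧
      ∀ u ∈ I.terminals, u ∈ c.2 → ∃ t ∈ R, u ∈ t.support := by
    intro c
    by_cases hc : c ∈ Cs
    · obtain ⟨S, hS, hSc⟩ := hn c hc
      obtain ⟨R, hR, hR1, hR2⟩ := hS.exists_root_tours
      exact ⟨R, fun _ => ⟨hR.trans hSc, hR1, hR2⟩⟩
    · exact ⟨∅, fun hc' => absurd hc' hc⟩
  choose R hR using key
  refine ⟨Cs.biUnion R, ⟨fun t ht => ?_, fun u hu _ => ?_⟩,
    Finset.card_biUnion_le.trans (Finset.sum_le_sum fun c hc => (hR c hc).1)⟩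
  · obtain ⟨c, hc, ht⟩ := Finset.mem_biUnion.1 ht
    exact ⟨fun _ _ => Set.mem_univ _, (hR c hc).2.1 t ht⟩
  · obtain ⟨c, hc, huc⟩ := hcov u hu
    obtain ⟨t, ht, hut⟩ := (hR c hc).2.2 u hu huc
    exact ⟨t, Finset.mem_biUnion.2 ⟨c, hc, ht⟩, hut⟩

/-- If the whole tree can be served by few tours, it is the only component. -/
theorem isComponent_iff_of_solvable (hroot : I.Solvable Γ (I.below I.root)) {c : Component V} :
    I.IsComponent Γ c ↔ c = I.below I.root := by
  have hleaf : I.IsLeafRoot Γ I.root :=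
    ⟨⟨hroot, Or.inl rfl⟩, fun u hu hne => absurd (I.isAncestor_root_iff.1 hu) hne⟩
  have huniq : ∀ v, I.IsLeafRoot Γ v → v = I.root := fun v hv =>
    (hleaf.eq_of_isAncestor hv (I.root_isAncestor v)).symm
  constructor
  · intro hc
    rcases isComponent_iff.1 hc with ⟨v, hv, rfl⟩ | ⟨b, -, -, hb, -⟩
    · rw [huniq v hv]
    · exfalso
      obtain ⟨v, hv, hbv⟩ := exists_isLeafRoot_of_mem_backbone hb.mem_backbone hb.1
      rw [huniq v hv] at hbv
      exact hb.1 (I.isAncestor_root_iff.1 hbv)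
  · rintro rfl
    exact .leaf hleaf

/-- The output of the algorithm is the value of a solution. -/
theorem exists_algorithmOutput_eq [Finite V]
    (hsolv : ∀ c, I.IsComponent Γ c → I.Solvable Γ c)
    (hcov : ∀ u ∈ I.terminals, ∃ c, I.IsComponent Γ c ∧ u ∈ c.2) :
    ∃ n : Component V → ℕ, (∀ c ∈ I.components Γ, I.solve Γ c = n c) ∧
      I.algorithmOutput Γ = ((∑ c ∈ I.components Γ, n c : ℕ) : ℕ∞) ∧
      ∃ S, I.IsFeasible I.root Set.univ I.limit S ∧ S.card ≤ ∑ c ∈ I.components Γ, n c := by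
  have hn : ∀ c ∈ I.components Γ, I.solve Γ c = ((I.solve Γ c).toNat : ℕ∞) := fun c hc =>
    (ENat.natCast_toNat (hsolv c (mem_components.1 hc))).symm
  refine ⟨fun c => (I.solve Γ c).toNat, hn, ?_, ?_⟩
  · rw [algorithmOutput, Nat.cast_sum]
    exact Finset.sum_congr rfl hn
  · refine exists_isFeasible_of_components _ _ (fun c hc => ?_) fun u hu => ?_
    · obtain ⟨S, hS, -, hSc⟩ := (hsolv c (mem_components.1 hc)).exists_serves
      exact ⟨S, hS, by rw [hSc]; simp⟩
    · obtain ⟨c, hc, huc⟩ := hcov u hu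
      exact ⟨c, mem_components.2 hc, huc⟩

/-- The number of components is small compared with the optimum. -/
theorem IsLarge.gamma_mul_card_components_le [Fintype V] {ι : Type*} (h : I.IsLarge Γ)
    (T : Finset ι) (A : ι → Finset V)
    (hA : ∀ i ∈ T, ∀ x ∈ A i, ∀ y, I.IsAncestor y x → y ∈ A i)
    (hlen : ∀ i ∈ T, 2 * ∑ x ∈ A i, I.parentWeight x ≤ I.limit)
    (hcov : ∀ u ∈ I.terminals, ∃ i ∈ T, u ∈ A i) :
    Γ * (I.components Γ).card ≤ 15 * T.card := by
  classical
  have hΓ := h.le_gamma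
  obtain ⟨e, he⟩ := h.exists_isDecomposition
  obtain ⟨σ, hσ, hσT⟩ := he.exists_share T A hA hlen h.two_mul_dist_le hcov
  set F := (I.components Γ).filter fun c => ∀ S, I.Serves c S → Γ / 2 ≤ (S.card : ℝ) with hF
  -- From `Γ / 2 ≤ 2 * σ c + 2` follows `σ c ≥ Γ / 4 - 1`, which is at least `Γ / 5` because `20 ≤
  -- Γ`.
  have h1 : ∑ _c ∈ F, Γ / 5 ≤ ∑ c ∈ I.components Γ, σ c := by
    refine (Finset.sum_le_sum fun c hc => ?_).trans
      (Finset.sum_le_sum_of_subset_of_nonneg (Finset.filter_subset _ _) fun c hc _ => (hσ c hc).1)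
    obtain ⟨hc, hlarge⟩ := Finset.mem_filter.1 hc
    obtain ⟨-, S, hS, hSc⟩ := hσ c hc
    have := hlarge S hS
    linarith
  rw [Finset.sum_const, nsmul_eq_mul] at h1
  have h2 : ((I.components Γ).card : ℝ) ≤ 3 * F.card := by exact_mod_cast h.card_components_le
  have h3 : Γ * ((I.components Γ).card : ℝ) ≤ Γ * (3 * F.card) :=
    mul_le_mul_of_nonneg_left h2 (by linarith)
  linarith

end TreeDVRP

/-! ### The approximation guarantee -/

theorem theorem3 (M : ℕ) (hM : 0 < M) (β γ : ℝ)
    (hBP : ∀ items : List ℝ, (∀ a ∈ items, a ∈ Set.Icc (0 : ℝ) 1) →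
      ∃ s : BinState, BinRun M items s ∧ (s.opened : ℝ) ≤ β * (optBinPacking items : ℝ) + γ)
    {V : Type*} [Finite V] (I : TreeDVRP V) (hI : I.IsNormalized)
    (hfeas : ∃ S, I.IsFeasible I.root Set.univ I.limit S)
    (ε : ℝ) (hε : 0 < ε) (hε_small : ε ^ 2 ≤ 1 / 20) :
    ∃ N : ℕ, I.algorithmOutput (1 / ε ^ 2) = (N : ℕ∞) ∧
      (∃ S, I.IsFeasible I.root Set.univ I.limit S ∧ S.card ≤ N) ∧
      (N : ℝ) ≤ (β + 30 * ε ^ 2 * (M : ℝ)) * (I.opt : ℝ) + γ := by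
  classical
  cases nonempty_fintype V
  have hunit := natCast_le_of_boundedSpace hBP
  have hβ : 0 ≤ β := zero_le_one.trans (one_le_of_boundedSpace hunit)
  have hε2 : 0 < ε ^ 2 := by positivity
  obtain ⟨T, hT, hTcard⟩ : ∃ T, I.IsFeasible I.root Set.univ I.limit T ∧ T.card = I.opt := by
    obtain ⟨S, hS⟩ := hfeas
    exact Nat.sInf_mem (s := {k : ℕ | ∃ S, I.IsFeasible I.root Set.univ I.limit S ∧ S.card = k})
      ⟨S.card, S, hS, rfl⟩
  have hD := TreeDVRP.two_mul_dist_le_of_isFeasible hI hT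
  set Γ : ℝ := 1 / ε ^ 2 with hΓ
  have hεΓ : ε ^ 2 * Γ = 1 := by rw [hΓ]; field_simp
  by_cases hroot : I.Solvable Γ (I.below I.root)
  · obtain ⟨n, hn, hout, hsol⟩ := TreeDVRP.exists_algorithmOutput_eq (I := I) (Γ := Γ)
      (fun c hc => by rw [(TreeDVRP.isComponent_iff_of_solvable hroot).1 hc]; exact hroot)
      (fun u _ => ⟨I.below I.root, (TreeDVRP.isComponent_iff_of_solvable hroot).2 rfl,
        I.root_isAncestor u⟩)
    refine ⟨_, hout, hsol, ?_⟩
    have hcs : I.components Γ = {I.below I.root} := by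
      ext c
      rw [TreeDVRP.mem_components, TreeDVRP.isComponent_iff_of_solvable hroot,
        Finset.mem_singleton]
    have hserves : I.Serves (I.below I.root) T := by
      refine ⟨fun t ht => ⟨fun x _ => I.root_isAncestor x, ?_⟩, fun u hu _ =>
        hT.2 u hu (Set.mem_univ u)⟩
      have := (hT.1 t ht).2
      simpa [TreeDVRP.below] using this
    have h1 := hroot.solve_le hserves
    rw [hn _ (by rw [hcs]; exact Finset.mem_singleton_self _)] at h1
    have h2 : n (I.below I.root) ≤ I.opt := by
      rw [← hTcard]
      exact_mod_cast h1
    have h3 : (n (I.below I.root) : ℝ) ≤ I.opt := by exact_mod_cast h2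
    have h4 : 0 ≤ 30 * ε ^ 2 * (M : ℝ) * (I.opt : ℝ) := by positivity
    rw [hcs, Finset.sum_singleton]
    -- Since `γ` may be negative, `N ≤ opt` alone is not enough. The bound for `opt` unit items
    -- gives `opt ≤ β * opt + γ`.
    linarith [hunit I.opt]
  · have h : I.IsLarge Γ := ⟨hI, by
      rw [hΓ, le_div_iff₀ hε2]; linarith, hD, hroot⟩
    obtain ⟨n, hn, hout, hsol⟩ := TreeDVRP.exists_algorithmOutput_eq (I := I) (Γ := Γ)
      (fun c hc => hc.solvable hI) (fun u hu => h.exists_isComponent hu)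
    refine ⟨_, hout, hsol, ?_⟩
    have hA : ∀ t ∈ T, ∀ x ∈ t.support.toFinset, ∀ y, I.IsAncestor y x → y ∈ t.support.toFinset :=
      fun t _ x hx y hyx => List.mem_toFinset.2 (hyx.mem_support (List.mem_toFinset.1 hx))
    have hlen : ∀ t ∈ T, 2 * ∑ x ∈ t.support.toFinset, I.parentWeight x ≤ I.limit := fun t ht => by
      have h1 := I.two_mul_sum_le_walkLength t
      have h2 := (hT.1 t ht).2
      omega
    have hcov : ∀ u ∈ I.terminals, ∃ t ∈ T, u ∈ t.support.toFinset := fun u hu => by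
      simpa using hT.2 u hu (Set.mem_univ u)
    obtain ⟨e, he⟩ := h.exists_isDecomposition
    obtain ⟨m, hm, hsum⟩ := he.exists_card_le T (fun t => t.support.toFinset) hA hlen hD hcov hβ hBP
    have hnm : ∑ c ∈ I.components Γ, n c ≤ ∑ c ∈ I.components Γ, m c := by
      refine Finset.sum_le_sum fun c hc => ?_
      obtain ⟨S, hS, hSc⟩ := hm c hc
      have h1 := ((TreeDVRP.mem_components.1 hc).solvable hI).solve_le hS
      rw [hn c hc] at h1
      exact le_trans (by exact_mod_cast h1) hSc
    have hnm' : ((∑ c ∈ I.components Γ, n c : ℕ) : ℝ) ≤ ((∑ c ∈ I.components Γ, m c : ℕ) : ℝ) := by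
      exact_mod_cast hnm
    have hcount := h.gamma_mul_card_components_le T (fun t => t.support.toFinset) hA hlen hcov
    have hcount' : ((I.components Γ).card : ℝ) ≤ 15 * ε ^ 2 * T.card := by
      calc ((I.components Γ).card : ℝ) = ε ^ 2 * (Γ * (I.components Γ).card) := by
            rw [← mul_assoc, hεΓ, one_mul]
        _ ≤ ε ^ 2 * (15 * T.card) := mul_le_mul_of_nonneg_left hcount hε2.le
        _ = 15 * ε ^ 2 * T.card := by ring
    -- Two groups for each component turn 15 into the constant 30.
    have hM' : 2 * (M : ℝ) * (I.components Γ).card ≤ 2 * M * (15 * ε ^ 2 * T.card) :=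
      mul_le_mul_of_nonneg_left hcount' (by positivity)
    rw [← hTcard]
    calc ((∑ c ∈ I.components Γ, n c : ℕ) : ℝ)
        ≤ β * T.card + γ + 2 * M * (15 * ε ^ 2 * T.card) := by linarith
      _ = (β + 30 * ε ^ 2 * (M : ℝ)) * (T.card : ℝ) + γ := by ring
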